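/- **Setting.** Let $\mathcal V$ be a class of algebras in a finite algebraic language, let $\mathrm{Fm}(X)$ be the formula (term) algebra over a set $X$ of variables, and fix the countable set of variables $\omega$. For a finite set $\Sigma$ of identities with set of variables $X=\mathrm{Var}(\Sigma)$, a $\mathcal V$-unifier of $\Sigma$ is a substitution $\sigma:\mathrm{Fm}(X)\to\mathrm{Fm}(\omega)$ with $\mathcal V\models\sigma(\varphi)\approx\sigma(\psi)$ for all $\varphi\approx\psi$ in $\Sigma$. Put $\sigma_2\preccurlyeq\sigma_1$ if there is a substitution $\tau:\mathrm{Fm}(\omega)\to\mathrm{Fm}(\omega)$ with $\mathcal V\models\tau(\sigma_1(x))\approx\sigma_2(x)$ for all $x\in X$, and put $\sigma_2\sqsubseteq\sigma_1$ if every identity over $X$ that is $\mathcal V$-unified by $\sigma_1$ is also $\mathcal V$-unified by $\sigma_2$. A $\mu$-set of a preordered set is a subset $M$ of pairwise incomparable elements such that every element lies below an element of $M$. A nonempty preordered set is unitary if it has a $\mu$-set of cardinality $1$, finitary if it has a finite $\mu$-set of cardinality greater than $1$, infinitary if it has an infinite $\mu$-set, and nullary if it has no $\mu$-set; these types are ordered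 by unitary $<$ finitary $<$ infinitary $<$ nullary. The unification type (respectively, exact type) of $\mathcal V$ is the maximal type of the set of $\mathcal V$-unifiers of $\Sigma$ preordered by $\preccurlyeq$ (respectively, $\sqsubseteq$), where $\Sigma$ ranges over the $\mathcal V$-unifiable finite sets of identities. A clause $\Sigma\Rightarrow\Delta$ ($\Sigma,\Delta$ finite sets of identities) is $\mathcal V$-admissible if every substitution $\mathrm{Fm}(\mathrm{Var}(\Sigma\cup\Delta))\to\mathrm{Fm}(\omega)$ that is a $\mathcal V$-unifier of $\Sigma$ is a $\mathcal V$-unifier of some member of $\Delta$. $\mathcal V$ is locally finite if its finitely generated members are finite. Let $\mathfrak B_\omega$ be the class of pseudocomplemented distributive lattices: algebras $(B,\wedge,\vee,\neg,\bot,\top)$ such that $(B,\wedge,\vee,\bot,\top)$ is a bounded distributive lattice and, for all $a,b\in B$, $a\wedge\neg b=a$ iff $a\wedge b=\bot$. For $n\in\mathbb N$ let $\mathbf B_n'$ be the pseudocomplemented distributive lattice obtained from the Boolean algebra with $n$ atoms by adding a new top element, and let $\mathfrak B_n$ be the subvariety of $\mathfrak B_\omega$ generated by $\mathbf B_n'$.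 Stone algebras are the pseudocomplemented distributive lattices satisfying $\neg x\vee\neg\neg x\approx\top$. **Statement.** 1. The class of Stone algebras is $\mathfrak B_1$; it has nullary unification type and unitary exact type. 2. Let $\mathcal V$ be $\mathfrak B_\omega$ or $\mathfrak B_n$ with $n\ge 2$. Then $\mathcal V$ has nullary unification type and finitary exact type. Moreover, $\mathcal V$ is locally finite; the clause $\{x\vee\neg x\approx\top\}\Rightarrow\{x\approx\top,\ \neg x\approx\top\}$ is $\mathcal V$-admissible; and neither $\{x\vee\neg x\approx\top\}\Rightarrow\{x\approx\top\}$ nor $\{x\vee\neg x\approx\top\}\Rightarrow\{\neg x\approx\top\}$ is $\mathcal V$-admissible. -/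

import Mathlib

universe u

/-! # Unification types and exact types of classes of algebras -/

namespace ExactUnif

open FirstOrder FirstOrder.Language

/-! ## Types of preordered sets -/

/-- The four possible types of a (nonempty) preordered set. -/
inductive UType where
  | unitary
  | finitary
  | infinitary
  | nullary

/-- Position in the order `unitary < finitary < infinitary < nullary`. -/
def UType.rank : UType → ℕ
  | .unitary => 0
  | .finitary => 1
  | .infinitary => 2
  | .nullary => 3

theorem UType.rank_injective : Function.Injective UType.rank := by
  intro a b h
  cases a <;> cases b <;> first | rfl | simp [UType.rank] at h

noncomputable instance : LinearOrder UType := LinearOrder.lift' UType.rank UType.rank_injective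

section Preordered

variable {P : Type*} (r : P → P → Prop)

/-- `M` is a complete set for `(P, r)`: every element lies `r`-below an element of `M`. -/
def IsCompleteSet (M : Set P) : Prop := ∀ x, ∃ y ∈ M, r x y

/-- A `μ`-set: a complete set of pairwise `r`-incomparable elements. -/
def IsMuSet (M : Set P) : Prop :=
  IsCompleteSet r M ∧ ∀ x ∈ M, ∀ y ∈ M, x ≠ y → ¬ r x y ∧ ¬ r y x

/-- The preordered set `(P, r)` has the given type. -/
def HasType : UType → Prop
  | .unitary => ∃ M : Set P, IsMuSet r M ∧ M.ncard = 1
  | .finitary => ∃ M : Set P, IsMuSet r M ∧ M.Finite ∧ 1 < M.ncard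
  | .infinitary => ∃ M : Set P, IsMuSet r M ∧ M.Infinite
  | .nullary => ¬ ∃ M : Set P, IsMuSet r M

end Preordered

/-! ## Classes of algebras, identities, unifiers -/

/-- A class of `L`-algebras (with carriers in `Type u`), for a language `L`. -/
abbrev AlgClass (L : FirstOrder.Language.{0, 0}) := (A : Type u) → [L.Structure A] → Prop

section Unification

variable {L : FirstOrder.Language.{0, 0}}

/-- The identity `φ ≈ ψ` is valid in the algebra `A`. -/
def Valid (A : Type*) [L.Structure A] {α : Type} (φ ψ : L.Term α) : Prop :=
  ∀ v : α → A, φ.realize v = ψ.realize v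

variable (K : AlgClass.{u} L)

/-- `K ⊨ φ ≈ ψ`: the identity is valid in every member of `K`. -/
def ClassValid {α : Type} (φ ψ : L.Term α) : Prop :=
  ∀ (A : Type u) [L.Structure A], K A → Valid A φ ψ

/-- A finite set of identities over the variables `ℕ`; a pair `(φ, ψ)` stands for `φ ≈ ψ`. -/
abbrev Identities (L : FirstOrder.Language.{0, 0}) := Finset (L.Term ℕ × L.Term ℕ)

/-- The finite set of variables occurring in a finite set of identities. -/
def vars (S : Identities L) : Finset ℕ :=
  S.biUnion fun e => e.1.varFinset ∪ e.2.varFinset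

/-- A substitution `Fm(X) → Fm(ω)`, given by the images of the variables in `X`. -/
abbrev Substitution (L : FirstOrder.Language.{0, 0}) (X : Finset ℕ) := X → L.Term ℕ

/-- The value of a substitution over `X` at a formula whose variables are in `X`
(other variables, which never occur below, are left unchanged). -/
def Substitution.app {X : Finset ℕ} (σ : Substitution L X) (φ : L.Term ℕ) : L.Term ℕ :=
  φ.subst fun n => if h : n ∈ X then σ ⟨n, h⟩ else Term.var n

/-- `σ` is a `K`-unifier of `S`. -/
def IsUnifier (S : Identities L) {X : Finset ℕ} (σ : Substitution L X) : Prop :=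
  ∀ e ∈ S, ClassValid K (σ.app e.1) (σ.app e.2)

/-- The set of `K`-unifiers of `S` over the variables of `S`. -/
def Unifiers (S : Identities L) : Type :=
  {σ : Substitution L (vars S) // IsUnifier K S σ}

/-- `σ₂ ≼ σ₁`: the substitution `σ₁` is more general than `σ₂` in `K`. -/
def LessGeneral {X : Finset ℕ} (σ₂ σ₁ : Substitution L X) : Prop :=
  ∃ τ : ℕ → L.Term ℕ, ∀ x : X, ClassValid K ((σ₁ x).subst τ) (σ₂ x)

/-- The set of identities over `X` that are `K`-unified by `σ`. This is the kernel of the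
composition of `σ` with the canonical map `Fm(ω) → F_K(ω)`. -/
def kernel {X : Finset ℕ} (σ : Substitution L X) : Set (L.Term X × L.Term X) :=
  {e | ClassValid K (e.1.subst σ) (e.2.subst σ)}

/-- `σ₂ ⊑ σ₁`: all identities `K`-unified by `σ₁` are `K`-unified by `σ₂`. -/
def LessExact {X : Finset ℕ} (σ₂ σ₁ : Substitution L X) : Prop :=
  kernel K σ₁ ⊆ kernel K σ₂

/-- The unification type of `K` is `t`: `t` is the maximal type of the set of `K`-unifiers,
preordered by `≼`, of a `K`-unifiable finite set of identities. -/
def HasUnificationType (t : UType) : Prop :=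
  IsGreatest {s | ∃ S : Identities L, Nonempty (Unifiers K S) ∧
    HasType (fun σ₂ σ₁ : Unifiers K S => LessGeneral K σ₂.1 σ₁.1) s} t

/-- The exact type of `K` is `t`: `t` is the maximal type of the set of `K`-unifiers,
preordered by `⊑`, of a `K`-unifiable finite set of identities. -/
def HasExactType (t : UType) : Prop :=
  IsGreatest {s | ∃ S : Identities L, Nonempty (Unifiers K S) ∧
    HasType (fun σ₂ σ₁ : Unifiers K S => LessExact K σ₂.1 σ₁.1) s} t

/-- The clause `S ⇒ D` is `K`-admissible: every substitution over its variables that is a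
`K`-unifier of `S` is a `K`-unifier of some member of `D`. -/
def Admissible (S D : Identities L) : Prop :=
  ∀ σ : Substitution L (vars S ∪ vars D), IsUnifier K S σ → ∃ e ∈ D, IsUnifier K {e} σ

/-- `K` is locally finite: its finitely generated members are finite. -/
def LocallyFiniteClass : Prop :=
  ∀ (A : Type u) [L.Structure A], K A → Structure.FG L A → Finite A

end Unification

/-! ## Pseudocomplemented distributive lattices -/

/-- The operation symbols `⊥`, `⊤`, `¬`, `∧`, `∨`. -/
inductive PFun : ℕ → Type
  | bot : PFun 0
  | top : PFun 0
  | neg : PFun 1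
  | inf : PFun 2
  | sup : PFun 2

/-- The algebraic language of pseudocomplemented distributive lattices. -/
def pLang : FirstOrder.Language.{0, 0} := ⟨PFun, fun _ => Empty⟩

section Operations

variable {A : Type*} [pLang.Structure A]

/-- The interpretation of `⊥`. -/
def pBot (A : Type*) [pLang.Structure A] : A := Structure.funMap (L := pLang) PFun.bot ![]

/-- The interpretation of `⊤`. -/
def pTop (A : Type*) [pLang.Structure A] : A := Structure.funMap (L := pLang) PFun.top ![]

/-- The interpretation of `¬`. -/
def pNeg (a : A) : A := Structure.funMap (L := pLang) PFun.neg ![a]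

/-- The interpretation of `∧`. -/
def pInf (a b : A) : A := Structure.funMap (L := pLang) PFun.inf ![a, b]

/-- The interpretation of `∨`. -/
def pSup (a b : A) : A := Structure.funMap (L := pLang) PFun.sup ![a, b]

end Operations

/-- The class `𝔅_ω` of pseudocomplemented distributive lattices: the operations `∧, ∨, ⊥, ⊤` are
those of a bounded distributive lattice, and `a ∧ ¬b = a` iff `a ∧ b = ⊥`. -/
def PDL : AlgClass.{u} pLang := fun A _ =>
  ∃ (_ : DistribLattice A) (_ : BoundedOrder A),
    (∀ a b : A, pInf a b = a ⊓ b) ∧ (∀ a b : A, pSup a b = a ⊔ b) ∧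
    pBot A = ⊥ ∧ pTop A = ⊤ ∧
    ∀ a b : A, pInf a (pNeg b) = a ↔ pInf a b = pBot A

/-- The class of Stone algebras: pseudocomplemented distributive lattices satisfying
`¬x ∨ ¬¬x = ⊤`. -/
def StoneAlg : AlgClass.{u} pLang := fun A _ =>
  PDL A ∧ ∀ a : A, pSup (pNeg a) (pNeg (pNeg a)) = pTop A

/-- The lattice `B_n'`: the Boolean algebra with `n` atoms together with a new top element. -/
abbrev BPrime (n : ℕ) : Type := WithTop (Set (Fin n))

open Classical in
/-- The pseudocomplement on `B_n'`. -/
noncomputable def BPrime.neg {n : ℕ} : BPrime n → BPrime n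
  | ⊤ => ⊥
  | (a : Set (Fin n)) => if a = ⊥ then ⊤ else ((aᶜ : Set (Fin n)) : BPrime n)

/-- `B_n'` as an algebra. -/
noncomputable instance (n : ℕ) : pLang.Structure (BPrime n) where
  funMap {_} f := match f with
    | PFun.bot => fun _ => ⊥
    | PFun.top => fun _ => ⊤
    | PFun.neg => fun x => BPrime.neg (x 0)
    | PFun.inf => fun x => x 0 ⊓ x 1
    | PFun.sup => fun x => x 0 ⊔ x 1
  RelMap r := nomatch r

/-- `B_n'` is indeed a pseudocomplemented distributive lattice. -/
theorem BPrime.pdl (n : ℕ) : PDL (BPrime n) := by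
  refine ⟨inferInstance, inferInstance, fun _ _ => rfl, fun _ _ => rfl, rfl, rfl, ?_⟩
  intro a b
  change a ⊓ BPrime.neg b = a ↔ a ⊓ b = ⊥
  have hbot : (⊥ : BPrime n) = ((⊥ : Set (Fin n)) : BPrime n) := rfl
  induction b using WithTop.recTopCoe with
  | top => simp [BPrime.neg, eq_comm]
  | coe b =>
    by_cases hb : b = ⊥
    · subst hb
      rw [← hbot]
      simp [BPrime.neg, hbot]
      exact (bot_le : (⊥ : BPrime n) ≤ a)
    · induction a using WithTop.recTopCoe with
      | top =>
        simp [BPrime.neg, hbot]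
      | coe a =>
        simp only [BPrime.neg, if_neg hb, hbot]
        rw [← WithTop.coe_inf, ← WithTop.coe_inf, WithTop.coe_eq_coe, WithTop.coe_eq_coe,
          inf_eq_left, ← disjoint_iff, le_compl_iff_disjoint_right]

/-- The class `𝔅_n`: the equational subclass of `𝔅_ω` generated by `B_n'`, that is, the
pseudocomplemented distributive lattices satisfying every identity valid in `B_n'`. -/
def BVar (n : ℕ) : AlgClass.{u} pLang := fun A _ =>
  PDL A ∧ ∀ φ ψ : pLang.Term ℕ, Valid (BPrime n) φ ψ → Valid A φ ψ

/-! ## The identities of the clause -/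

/-- The variable `x`. -/
def tX : pLang.Term ℕ := Term.var 0

/-- The formula `⊤`. -/
def tTop : pLang.Term ℕ := Term.func (L := pLang) PFun.top ![]

/-- The formula `¬φ`. -/
def tNeg (φ : pLang.Term ℕ) : pLang.Term ℕ := Term.func (L := pLang) PFun.neg ![φ]

/-- The formula `φ ∨ ψ`. -/
def tSup (φ ψ : pLang.Term ℕ) : pLang.Term ℕ := Term.func (L := pLang) PFun.sup ![φ, ψ]

/-- The identity `x ∨ ¬x ≈ ⊤`. -/
def idLEM : pLang.Term ℕ × pLang.Term ℕ := (tSup tX (tNeg tX), tTop)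

/-- The identity `x ≈ ⊤`. -/
def idX : pLang.Term ℕ × pLang.Term ℕ := (tX, tTop)

/-- The identity `¬x ≈ ⊤`. -/
def idNegX : pLang.Term ℕ × pLang.Term ℕ := (tNeg tX, tTop)

open Classical in
/-- The set `{x ≈ ⊤, ¬x ≈ ⊤}`. -/
noncomputable def idXOrNegX : Identities pLang := {idX, idNegX}

end ExactUnif

/-!
# Unification and exact types of pseudocomplemented distributive lattices

Apart from what is special to Stone algebras, the only facts used about a class `K` are that its
members are pseudocomplemented distributive lattices and that the identities valid in `K` hold in
some `B_n'`.

*Nullary unification type.* The identity `x₀ ∧ x₁ ≈ x₂ ∨ x₃` witnesses it. If `σ₁` and `σ₂` are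
unifiers, then so is `(y ∧ σ₁) ∨ (z ∧ σ₂) ∨ (y ∧ z)` with fresh `y` and `z` (`meet_eq_join_glue`),
and it specializes to both of them. So the unifiers are directed, and a `μ`-set would contain a
greatest unifier `σ`. It would have to specialize, for every `N`, to
`x₀ ↦ ⋁ uᵢ`, `x₁ ↦ ⋁ wᵢ`, `x₂ ↦ ⋁_{i ≠ j} uᵢ ∧ wⱼ`, `x₃ ↦ ⋁ uᵢ ∧ wᵢ` with `i, j < N`. A pigeonhole
argument on valuations in `B_n'`, together with the monotonicity of terms on valuations with
prescribed pseudocomplements (`realize_mono`), excludes this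
(`exists_not_lessGeneral_gridUnifier`).

*Local finiteness.* The value of `¬φ` depends only on the two-valued truth table of `φ`
(`compl_realize_le`). So in finitely many variables the negated terms take finitely many values, and
all terms take values in the sublattice generated by these and the generators
(`finite_range_realize`). Consequently there are only finitely many kernels of substitutions over a
finite set of variables (`finite_range_kernel`), and exact types are at most finitary.

*Stone algebras.* Prime ideals give enough homomorphisms to the three-element chain `B_1'`
(`realize_stoneMap`), so Stone algebras form the class `𝔅_1`. There `¬y` takes complemented values,
and `(¬y ∧ σ₁) ∨ (¬¬y ∧ σ₂)` is a common upper bound of two unifiers of any set of identities; so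
the finitely many kernels have a least element and the exact type is unitary.

*The clause.* For `n ≥ 2`, two two-valued valuations are the images of one valuation in `B_n'` under
the homomorphisms given by two atoms. As `B_n'` has no complemented elements except its bounds, a
term `φ` with `φ ∨ ¬φ ≈ ⊤` is constant under two-valued valuations (`two_valued_constant`), so
`φ ≈ ⊤` or `¬φ ≈ ⊤`. In particular the unifiers `x ↦ ⊥` and `x ↦ ⊤` of `x ∨ ¬x ≈ ⊤` have no
common upper bound and the exact type is finitary.
-/

namespace ExactUnif

open FirstOrder FirstOrder.Language

/-! ### Preordered sets -/

section Preordered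

variable {P : Type*} {r : P → P → Prop}

theorem UType.le_def {s t : UType} : s ≤ t ↔ s.rank ≤ t.rank := Iff.rfl

theorem UType.le_nullary (s : UType) : s ≤ .nullary := by
  cases s <;> simp [UType.le_def, UType.rank]

/-- In a directed preordered set an element of a `μ`-set is maximal, hence greatest. -/
theorem hasType_nullary_of_directed [Nonempty P] (hr : ∀ x y z, r x y → r y z → r x z)
    (hdir : ∀ x y, ∃ z, r x z ∧ r y z) (hg : ¬ ∃ g, ∀ x, r x g) : HasType r .nullary := by
  rintro ⟨M, hM, hinc⟩
  obtain ⟨m, hm, -⟩ := hM (Classical.arbitrary P)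
  refine hg ⟨m, fun x => ?_⟩
  obtain ⟨z, hxz, hmz⟩ := hdir x m
  obtain ⟨m', hm', hz⟩ := hM z
  by_cases h : m = m'
  · exact h ▸ hr _ _ _ hxz hz
  · exact absurd (hr _ _ _ hmz hz) (hinc m hm m' hm' h).1

/-- If there is a greatest element, then every `μ`-set is a singleton. -/
theorem IsMuSet.ncard_eq_one (hr : ∀ x y z, r x y → r y z → r x z) {g : P} (hg : ∀ x, r x g)
    {M : Set P} (hM : IsMuSet r M) : M.ncard = 1 := by
  obtain ⟨m, hm, hgm⟩ := hM.1 g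
  rw [Set.ncard_eq_one]
  refine ⟨m, Set.eq_singleton_iff_unique_mem.2 ⟨hm, fun x hx => ?_⟩⟩
  by_contra hne
  exact (hM.2 x hx m hm hne).1 (hr _ _ _ (hg x) hgm)

theorem hasType_unitary_of_greatest {g : P} (hg : ∀ x, r x g) : HasType r .unitary :=
  ⟨{g}, ⟨fun x => ⟨g, rfl, hg x⟩, fun _ hx _ hy h => absurd (hx.trans hy.symm) h⟩,
    Set.ncard_singleton g⟩

theorem HasType.eq_unitary_of_greatest (hr : ∀ x y z, r x y → r y z → r x z) {g : P}
    (hg : ∀ x, r x g) {s : UType} (hs : HasType r s) : s = .unitary := by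
  cases s with
  | unitary => rfl
  | finitary =>
    obtain ⟨M, hM, -, h⟩ := hs
    rw [hM.ncard_eq_one hr hg] at h
    exact absurd h (lt_irrefl _)
  | infinitary =>
    obtain ⟨M, hM, h⟩ := hs
    have := hM.ncard_eq_one hr hg
    rw [h.ncard] at this
    exact absurd this zero_ne_one
  | nullary => exact absurd ⟨_, (hasType_unitary_of_greatest hg).choose_spec.1⟩ hs

section Finite

variable {Q : Type*} [PartialOrder Q] {k : P → Q}

/-- Choosing a preimage of every minimal value of `k` gives a `μ`-set. -/
theorem exists_finite_isMuSet (hk : (Set.range k).Finite) (hr : ∀ x y, r x y ↔ k y ≤ k x) :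
    ∃ M : Set P, IsMuSet r M ∧ M.Finite := by
  classical
  have hmin : ∀ c : {c // Minimal (· ∈ Set.range k) c}, ∃ x, k x = c := fun c => c.2.1
  choose f hf using hmin
  have : Finite {c // Minimal (· ∈ Set.range k) c} :=
    (hk.subset fun c hc => hc.1 : {c | Minimal (· ∈ Set.range k) c}.Finite)
  refine ⟨Set.range f, ⟨fun x => ?_, ?_⟩, Set.finite_range f⟩
  · obtain ⟨c, hc, hcm⟩ := hk.exists_le_minimal (Set.mem_range_self x)
    exact ⟨f ⟨c, hcm⟩, Set.mem_range_self _, (hr _ _).2 (by rw [hf]; exact hc)⟩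
  · rintro _ ⟨c, rfl⟩ _ ⟨d, rfl⟩ hne
    have hcd : ∀ c d, r (f c) (f d) → c = d := fun c d h => by
      rw [hr, hf, hf] at h
      exact Subtype.ext (le_antisymm (c.2.2 d.2.1 h) h)
    exact ⟨fun h => hne (congrArg f (hcd _ _ h)), fun h => hne (congrArg f (hcd _ _ h)).symm⟩

theorem IsMuSet.finite_of_finite_range (hk : (Set.range k).Finite)
    (hr : ∀ x y, r x y ↔ k y ≤ k x) {M : Set P} (hM : IsMuSet r M) : M.Finite := by
  refine Set.Finite.of_finite_image (f := k) (hk.subset (Set.image_subset_range _ _)) ?_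
  intro x hx y hy hxy
  by_contra hne
  exact (hM.2 x hx y hy hne).1 ((hr _ _).2 hxy.ge)

theorem HasType.le_finitary_of_finite_range (hk : (Set.range k).Finite)
    (hr : ∀ x y, r x y ↔ k y ≤ k x) {s : UType} (hs : HasType r s) : s ≤ .finitary := by
  cases s with
  | unitary => simp [UType.le_def, UType.rank]
  | finitary => exact le_rfl
  | infinitary =>
    obtain ⟨M, hM, h⟩ := hs
    exact absurd (hM.finite_of_finite_range hk hr) h
  | nullary =>
    obtain ⟨M, hM, -⟩ := exists_finite_isMuSet hk hr
    exact absurd ⟨M, hM⟩ hs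

theorem hasType_finitary [Nonempty P] (hk : (Set.range k).Finite)
    (hr : ∀ x y, r x y ↔ k y ≤ k x) (hg : ¬ ∃ g, ∀ x, r x g) : HasType r .finitary := by
  obtain ⟨M, hM, hfin⟩ := exists_finite_isMuSet hk hr
  refine ⟨M, hM, hfin, ?_⟩
  obtain ⟨m, hm, -⟩ := hM.1 (Classical.arbitrary P)
  have := hfin.to_subtype
  rw [Set.one_lt_ncard_iff_nontrivial]
  by_contra hnt
  rw [Set.not_nontrivial_iff] at hnt
  refine hg ⟨m, fun x => ?_⟩
  obtain ⟨y, hy, hxy⟩ := hM.1 x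
  exact hnt hy hm ▸ hxy

/-- A directed preordered set with finitely many classes has a greatest element. -/
theorem exists_greatest_of_directed [Nonempty P] (hk : (Set.range k).Finite)
    (hr : ∀ x y, r x y ↔ k y ≤ k x) (hdir : ∀ x y, ∃ z, r x z ∧ r y z) : ∃ g, ∀ x, r x g := by
  obtain ⟨c, -, hcm⟩ := hk.exists_le_minimal (Set.mem_range_self (Classical.arbitrary P))
  obtain ⟨g, rfl⟩ := hcm.1
  refine ⟨g, fun x => ?_⟩
  obtain ⟨z, hxz, hgz⟩ := hdir x g
  rw [hr] at hxz hgz ⊢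
  exact (hcm.2 (Set.mem_range_self z) hgz).trans hxz

end Finite

end Preordered

/-! ### Pseudocomplemented distributive lattices -/

/-- A bounded distributive lattice with pseudocomplements: the bundled order-theoretic counterpart
of the class `PDL`. -/
class PseudocomplLattice (A : Type*) extends DistribLattice A, BoundedOrder A, Compl A where
  le_compl_iff : ∀ a b : A, a ≤ bᶜ ↔ a ⊓ b = ⊥

/-- The basic operations of the algebra `A` are those of the pseudocomplemented lattice `A`. -/
class IsModel (A : Type*) [pLang.Structure A] [PseudocomplLattice A] : Prop where
  pBot_eq : pBot A = ⊥
  pTop_eq : pTop A = ⊤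
  pNeg_eq : ∀ a : A, pNeg a = aᶜ
  pInf_eq : ∀ a b : A, pInf a b = a ⊓ b
  pSup_eq : ∀ a b : A, pSup a b = a ⊔ b

open IsModel (pBot_eq pTop_eq pNeg_eq pInf_eq pSup_eq)

theorem PDL.exists_isModel {A : Type u} [pLang.Structure A] (h : PDL A) :
    ∃ _ : PseudocomplLattice A, IsModel A := by
  obtain ⟨i, j, hinf, hsup, hbot, htop, hneg⟩ := h
  let inst : PseudocomplLattice A := { i, j with
    compl := pNeg
    le_compl_iff := fun a b => ?_ }
  · exact ⟨inst, ⟨hbot, htop, fun _ => rfl, hinf, hsup⟩⟩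
  · have := hneg a b
    rw [hinf, hinf, hbot] at this
    exact inf_eq_left.symm.trans this

theorem IsModel.pdl (A : Type u) [pLang.Structure A] [PseudocomplLattice A] [IsModel A] :
    PDL A := by
  refine ⟨inferInstance, inferInstance, pInf_eq, pSup_eq, pBot_eq, pTop_eq, fun a b => ?_⟩
  rw [pInf_eq, pInf_eq, pNeg_eq, pBot_eq, inf_eq_left]
  exact PseudocomplLattice.le_compl_iff a b

namespace PseudocomplLattice

variable {A : Type*} [PseudocomplLattice A] {a b c : A}

theorem le_compl (h : a ⊓ b = ⊥) : a ≤ bᶜ := (le_compl_iff a b).2 h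

theorem inf_compl_self (a : A) : a ⊓ aᶜ = ⊥ := by
  rw [inf_comm]; exact (le_compl_iff _ _).1 le_rfl

theorem compl_inf_self (a : A) : aᶜ ⊓ a = ⊥ := (le_compl_iff _ _).1 le_rfl

theorem le_compl_compl (a : A) : a ≤ aᶜᶜ := le_compl (inf_compl_self a)

theorem compl_anti (h : a ≤ b) : bᶜ ≤ aᶜ :=
  le_compl (le_bot_iff.1 ((inf_le_inf_left _ h).trans_eq (compl_inf_self b)))

theorem compl_sup_eq (a b : A) : (a ⊔ b)ᶜ = aᶜ ⊓ bᶜ := by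
  refine le_antisymm (le_inf (compl_anti le_sup_left) (compl_anti le_sup_right)) (le_compl ?_)
  rw [inf_sup_left, inf_right_comm, compl_inf_self, bot_inf_eq, inf_assoc, compl_inf_self,
    inf_bot_eq, bot_sup_eq]

theorem compl_inf_eq (a b : A) : (a ⊓ b)ᶜ = (aᶜ ⊔ bᶜ)ᶜᶜ := by
  refine le_antisymm ?_ ?_
  · rw [compl_sup_eq]
    refine le_compl ?_
    have h1 : (a ⊓ b)ᶜ ⊓ aᶜᶜ ⊓ b ≤ aᶜ := by
      refine le_compl (le_bot_iff.1 ?_)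
      calc (a ⊓ b)ᶜ ⊓ aᶜᶜ ⊓ b ⊓ a ≤ (a ⊓ b)ᶜ ⊓ (a ⊓ b) :=
            le_inf (inf_le_left.trans (inf_le_left.trans inf_le_left))
              (le_inf inf_le_right (inf_le_left.trans inf_le_right))
        _ = ⊥ := compl_inf_self _
    have h2 : (a ⊓ b)ᶜ ⊓ aᶜᶜ ≤ bᶜ := by
      refine le_compl (le_bot_iff.1 ?_)
      calc (a ⊓ b)ᶜ ⊓ aᶜᶜ ⊓ b ≤ aᶜᶜ ⊓ aᶜ := le_inf (inf_le_left.trans inf_le_right) h1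
        _ = ⊥ := compl_inf_self _
    refine le_bot_iff.1 ?_
    calc (a ⊓ b)ᶜ ⊓ (aᶜᶜ ⊓ bᶜᶜ) ≤ bᶜ ⊓ bᶜᶜ :=
          le_inf ((inf_le_inf_left _ inf_le_left).trans h2) (inf_le_right.trans inf_le_right)
      _ = ⊥ := inf_compl_self _
  · refine compl_anti ?_
    rw [compl_sup_eq]
    exact inf_le_inf (le_compl_compl a) (le_compl_compl b)

theorem compl_triple (a : A) : aᶜᶜᶜ = aᶜ :=
  le_antisymm (compl_anti (le_compl_compl a)) (le_compl_compl _)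

theorem compl_compl_inf (a b : A) : (a ⊓ b)ᶜᶜ = aᶜᶜ ⊓ bᶜᶜ := by
  rw [compl_inf_eq, compl_triple, compl_sup_eq]

theorem eq_bot_of_inf_eq_bot (h : a ⊓ b = ⊥) (h' : a ⊓ bᶜ = ⊥) : a = ⊥ := by
  rwa [inf_eq_left.2 (le_compl h)] at h'

@[simp] theorem compl_bot : (⊥ : A)ᶜ = ⊤ := top_le_iff.1 (le_compl (inf_bot_eq _))

@[simp] theorem compl_top : (⊤ : A)ᶜ = ⊥ := by rw [← inf_top_eq (⊤ᶜ : A), compl_inf_self]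

end PseudocomplLattice

/-! ### Terms -/

/-- The term `⊥`, in an arbitrary set of variables. -/
def botT {α : Type} : pLang.Term α := Term.func (L := pLang) PFun.bot ![]

/-- The term `⊤`, in an arbitrary set of variables. -/
def topT {α : Type} : pLang.Term α := Term.func (L := pLang) PFun.top ![]

/-- The term `¬φ`, in an arbitrary set of variables. -/
def negT {α : Type} (φ : pLang.Term α) : pLang.Term α := Term.func (L := pLang) PFun.neg ![φ]

/-- The term `φ ∧ ψ`, in an arbitrary set of variables. -/
def infT {α : Type} (φ ψ : pLang.Term α) : pLang.Term α :=
  Term.func (L := pLang) PFun.inf ![φ, ψ]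

/-- The term `φ ∨ ψ`, in an arbitrary set of variables. -/
def supT {α : Type} (φ ψ : pLang.Term α) : pLang.Term α :=
  Term.func (L := pLang) PFun.sup ![φ, ψ]

/-- Induction on terms, with one case for each of the operations. -/
theorem pTerm_induction {α : Type} {P : pLang.Term α → Prop} (var : ∀ x, P (Term.var x))
    (bot : P botT) (top : P topT) (neg : ∀ φ, P φ → P (negT φ))
    (inf : ∀ φ ψ, P φ → P ψ → P (infT φ ψ)) (sup : ∀ φ ψ, P φ → P ψ → P (supT φ ψ))
    (φ : pLang.Term α) : P φ := by
  induction φ with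
  | var x => exact var x
  | func f ts ih =>
    cases f with
    | bot =>
      obtain rfl : ts = ![] := funext fun i => i.elim0
      exact bot
    | top =>
      obtain rfl : ts = ![] := funext fun i => i.elim0
      exact top
    | neg =>
      have h : ts = ![ts 0] := funext fun i => by fin_cases i; rfl
      rw [h]
      exact neg _ (ih 0)
    | inf =>
      have h : ts = ![ts 0, ts 1] := funext fun i => by fin_cases i <;> rfl
      rw [h]
      exact inf _ _ (ih 0) (ih 1)
    | sup =>
      have h : ts = ![ts 0, ts 1] := funext fun i => by fin_cases i <;> rfl
      rw [h]
      exact sup _ _ (ih 0) (ih 1)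

section Realize

variable {A : Type*} [pLang.Structure A] [PseudocomplLattice A] [IsModel A] {α : Type} (v : α → A)

@[simp] theorem realize_botT : (botT (α := α)).realize v = ⊥ :=
  Eq.trans (congrArg (Structure.funMap (L := pLang) PFun.bot) (funext fun i => i.elim0))
    (pBot_eq (A := A))

@[simp] theorem realize_topT : (topT (α := α)).realize v = ⊤ :=
  Eq.trans (congrArg (Structure.funMap (L := pLang) PFun.top) (funext fun i => i.elim0))
    (pTop_eq (A := A))

@[simp] theorem realize_negT (φ : pLang.Term α) : (negT φ).realize v = (φ.realize v)ᶜ :=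
  Eq.trans (congrArg (Structure.funMap (L := pLang) PFun.neg)
    (funext fun i => by fin_cases i; rfl)) (pNeg_eq (φ.realize v))

@[simp] theorem realize_infT (φ ψ : pLang.Term α) :
    (infT φ ψ).realize v = φ.realize v ⊓ ψ.realize v :=
  Eq.trans (congrArg (Structure.funMap (L := pLang) PFun.inf)
    (funext fun i => by fin_cases i <;> rfl)) (pInf_eq (φ.realize v) (ψ.realize v))

@[simp] theorem realize_supT (φ ψ : pLang.Term α) :
    (supT φ ψ).realize v = φ.realize v ⊔ ψ.realize v :=
  Eq.trans (congrArg (Structure.funMap (L := pLang) PFun.sup)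
    (funext fun i => by fin_cases i <;> rfl)) (pSup_eq (φ.realize v) (ψ.realize v))

@[simp] theorem realize_tTop (v : ℕ → A) : tTop.realize v = ⊤ := realize_topT v

@[simp] theorem realize_tNeg (v : ℕ → A) (φ : pLang.Term ℕ) :
    (tNeg φ).realize v = (φ.realize v)ᶜ := realize_negT v φ

@[simp] theorem realize_tSup (v : ℕ → A) (φ ψ : pLang.Term ℕ) :
    (tSup φ ψ).realize v = φ.realize v ⊔ ψ.realize v := realize_supT v φ ψ

end Realize

/-- A map that preserves the five operations preserves the values of terms. -/
theorem map_realize {A B : Type*} [pLang.Structure A] [PseudocomplLattice A] [IsModel A]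
    [pLang.Structure B] [PseudocomplLattice B] [IsModel B] (h : A → B) (hbot : h ⊥ = ⊥)
    (htop : h ⊤ = ⊤) (hneg : ∀ a, h aᶜ = (h a)ᶜ) (hinf : ∀ a b, h (a ⊓ b) = h a ⊓ h b)
    (hsup : ∀ a b, h (a ⊔ b) = h a ⊔ h b) {α : Type} (v : α → A) (φ : pLang.Term α) :
    h (φ.realize v) = φ.realize (h ∘ v) := by
  induction φ using pTerm_induction <;> simp_all

/-! ### Transfer between algebras -/

instance {ι : Type*} (A : ι → Type*) [∀ i, pLang.Structure (A i)] : pLang.Structure (∀ i, A i) where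
  funMap f xs i := Structure.funMap f fun j => xs j i
  RelMap r := nomatch r

theorem realize_pi {ι : Type*} {A : ι → Type*} [∀ i, pLang.Structure (A i)] {α : Type}
    (v : α → ∀ i, A i) (φ : pLang.Term α) (i : ι) :
    φ.realize v i = φ.realize fun x => v x i := by
  induction φ with
  | var x => rfl
  | func f ts ih =>
    simp only [Term.realize_func, ← ih]
    rfl

theorem PDL.pi {ι : Type u} (A : ι → Type u) [∀ i, pLang.Structure (A i)]
    (h : ∀ i, PDL (A i)) : PDL (∀ i, A i) := by
  choose inst model using fun i => (h i).exists_isModel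
  let _ : PseudocomplLattice (∀ i, A i) :=
    { (inferInstance : DistribLattice (∀ i, A i)), (inferInstance : BoundedOrder (∀ i, A i)) with
      compl := fun a i => (a i)ᶜ
      le_compl_iff := fun a b => by
        simp only [Pi.le_def, PseudocomplLattice.le_compl_iff, funext_iff]
        rfl }
  have : IsModel (∀ i, A i) := by
    constructor
    · ext i
      exact Eq.trans (congrArg _ (funext fun j => j.elim0)) (pBot_eq (A := A i))
    · ext i
      exact Eq.trans (congrArg _ (funext fun j => j.elim0)) (pTop_eq (A := A i))
    · intro a
      ext i
      exact Eq.trans (congrArg _ (funext fun j => by fin_cases j; rfl)) (pNeg_eq (a i))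
    · intro a b
      ext i
      exact Eq.trans (congrArg _ (funext fun j => by fin_cases j <;> rfl)) (pInf_eq (a i) (b i))
    · intro a b
      ext i
      exact Eq.trans (congrArg _ (funext fun j => by fin_cases j <;> rfl)) (pSup_eq (a i) (b i))
  exact IsModel.pdl _

instance (A : Type*) [pLang.Structure A] : pLang.Structure (ULift.{u} A) :=
  Equiv.ulift.symm.inducedStructure

theorem down_realize {A : Type*} [pLang.Structure A] {α : Type} (v : α → ULift.{u} A)
    (φ : pLang.Term α) : (φ.realize v).down = φ.realize fun x => (v x).down := by
  induction φ with
  | var x => rfl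
  | func f ts ih =>
    simp only [Term.realize_func, ← ih]
    rfl

theorem valid_ulift_iff {A : Type*} [pLang.Structure A] {α : Type} (φ ψ : pLang.Term α) :
    Valid (ULift.{u} A) φ ψ ↔ Valid A φ ψ := by
  refine ⟨fun h v => ?_, fun h v => ULift.down_injective ?_⟩
  · have := congrArg ULift.down (h fun x => ⟨v x⟩)
    rwa [down_realize, down_realize] at this
  · rw [down_realize, down_realize]
    exact h _

theorem PDL.ulift {A : Type} [pLang.Structure A] (h : PDL A) : PDL (ULift.{u} A) := by
  obtain ⟨inst, model⟩ := h.exists_isModel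
  let _ : PseudocomplLattice (ULift.{u} A) :=
    { (inferInstance : DistribLattice (ULift.{u} A)) with
      top := ⟨⊤⟩
      le_top := fun a => le_top (a := a.down)
      bot := ⟨⊥⟩
      bot_le := fun a => bot_le (a := a.down)
      compl := fun a => ⟨a.downᶜ⟩
      le_compl_iff := fun a b =>
        (PseudocomplLattice.le_compl_iff a.down b.down).trans ULift.down_injective.eq_iff }
  have : IsModel (ULift.{u} A) := by
    constructor
    · exact ULift.ext _ _ (Eq.trans (congrArg
        (Structure.funMap (L := pLang) (M := A) PFun.bot) (funext fun j => j.elim0)) (pBot_eq (A := A)))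
    · exact ULift.ext _ _ (Eq.trans (congrArg
        (Structure.funMap (L := pLang) (M := A) PFun.top) (funext fun j => j.elim0)) (pTop_eq (A := A)))
    · intro a
      exact ULift.ext _ _ (Eq.trans (congrArg
        (Structure.funMap (L := pLang) (M := A) PFun.neg) (funext fun j => by fin_cases j; rfl)) (pNeg_eq a.down))
    · intro a b
      exact ULift.ext _ _
        (Eq.trans (congrArg
          (Structure.funMap (L := pLang) (M := A) PFun.inf) (funext fun j => by fin_cases j <;> rfl)) (pInf_eq a.down b.down))
    · intro a b
      exact ULift.ext _ _
        (Eq.trans (congrArg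
          (Structure.funMap (L := pLang) (M := A) PFun.sup) (funext fun j => by fin_cases j <;> rfl)) (pSup_eq a.down b.down))
  exact IsModel.pdl _

/-! ### The algebras `B_n'` -/

namespace BPrime

noncomputable instance (n : ℕ) : PseudocomplLattice (BPrime n) where
  compl := BPrime.neg
  le_compl_iff a b := by
    obtain ⟨_, _, -, -, -, -, h⟩ := BPrime.pdl n
    exact inf_eq_left.symm.trans (h a b)

instance (n : ℕ) : IsModel (BPrime n) :=
  ⟨rfl, rfl, fun _ => rfl, fun _ _ => rfl, fun _ _ => rfl⟩

variable {n : ℕ}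

theorem bot_eq : (⊥ : BPrime n) = ((∅ : Set (Fin n)) : BPrime n) := rfl

theorem compl_coe {s : Set (Fin n)} (hs : s.Nonempty) :
    (s : BPrime n)ᶜ = ((sᶜ : Set (Fin n)) : BPrime n) :=
  if_neg hs.ne_empty

theorem eq_bot_or_eq_top (a : BPrime 0) : a = ⊥ ∨ a = ⊤ := by
  induction a using WithTop.recTopCoe with
  | top => exact Or.inr rfl
  | coe s => exact Or.inl (by rw [bot_eq, Subsingleton.elim s ∅])

theorem bot_ne_top : (⊥ : BPrime n) ≠ ⊤ := WithTop.coe_ne_top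

end BPrime

/-! ### Local finiteness -/

section LocallyFinite

open PseudocomplLattice

variable {A : Type*} [PseudocomplLattice A] {X : Type}

open Classical in
/-- The conjunction of literals, over the variables in `F`, described by the two-valued
valuation `s`. -/
noncomputable def minterm (v : X → A) (F : Finset X) (s : X → BPrime 0) : A :=
  F.inf fun x => if s x = ⊤ then v x else (v x)ᶜ

/-- The join of all minterms is dense. -/
theorem eq_bot_of_inf_minterm (v : X → A) (F : Finset X) (z : A)
    (h : ∀ s, z ⊓ minterm v F s = ⊥) : z = ⊥ := by
  classical
  induction F using Finset.induction_on generalizing z with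
  | empty => simpa [minterm] using h fun _ => ⊤
  | insert x F hx ih =>
    have key : ∀ (t : BPrime 0) (s : X → BPrime 0), z ⊓ (if t = ⊤ then v x else (v x)ᶜ) ⊓
        minterm v F s = ⊥ := by
      intro t s
      have hF : minterm v F s = minterm v F (Function.update s x t) :=
        Finset.inf_congr rfl fun y hy => by
          rw [Function.update_of_ne (ne_of_mem_of_not_mem hy hx)]
      have := h (Function.update s x t)
      rwa [minterm, Finset.inf_insert, Function.update_self, ← inf_assoc, ← minterm, ← hF] at this
    refine eq_bot_of_inf_eq_bot (b := v x) (ih _ fun s => ?_) (ih _ fun s => ?_)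
    · simpa using key ⊤ s
    · simpa [BPrime.bot_ne_top] using key ⊥ s

variable [pLang.Structure A] [IsModel A]

/-- Below an element that decides each variable in the same way as the two-valued valuation `s`,
every term behaves, up to double negation, as its value under `s`. -/
theorem le_compl_of_realize_two (v : X → A) (s : X → BPrime 0) (m : A)
    (hm : ∀ x, (s x = ⊤ → m ≤ (v x)ᶜᶜ) ∧ (s x = ⊥ → m ≤ (v x)ᶜ)) (φ : pLang.Term X) :
    (φ.realize s = ⊤ → m ≤ (φ.realize v)ᶜᶜ) ∧ (φ.realize s = ⊥ → m ≤ (φ.realize v)ᶜ) := by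
  have hne := BPrime.bot_ne_top (n := 0)
  induction φ using pTerm_induction with
  | var x => exact hm x
  | bot => simp [hne]
  | top => simp [hne.symm]
  | neg φ ih =>
    rw [realize_negT, realize_negT, compl_triple]
    rcases BPrime.eq_bot_or_eq_top (φ.realize s) with h | h
    · simpa [h, hne.symm] using ih.2 h
    · simpa [h, hne] using ih.1 h
  | inf φ ψ ih ih' =>
    rw [realize_infT, realize_infT]
    rcases BPrime.eq_bot_or_eq_top (φ.realize s) with h | h
    · simpa [h, hne] using (ih.2 h).trans (compl_anti inf_le_left)
    rcases BPrime.eq_bot_or_eq_top (ψ.realize s) with h' | h'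
    · simpa [h', hne] using (ih'.2 h').trans (compl_anti inf_le_right)
    · simpa [h, h', hne.symm, compl_compl_inf] using ⟨ih.1 h, ih'.1 h'⟩
  | sup φ ψ ih ih' =>
    rw [realize_supT, realize_supT]
    rcases BPrime.eq_bot_or_eq_top (φ.realize s) with h | h
    · rcases BPrime.eq_bot_or_eq_top (ψ.realize s) with h' | h'
      · simpa [h, h', hne, compl_sup_eq] using ⟨ih.2 h, ih'.2 h'⟩
      · simpa [h', hne.symm] using
          (ih'.1 h').trans (compl_anti (compl_anti le_sup_right))
    · simpa [h, hne.symm] using (ih.1 h).trans (compl_anti (compl_anti le_sup_left))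

/-- The value of a negated term depends only on the two-valued truth table of the term. -/
theorem compl_realize_le [Finite X] (v : X → A) {φ ψ : pLang.Term X}
    (h : ∀ s : X → BPrime 0, φ.realize s = ψ.realize s) :
    (φ.realize v)ᶜ ≤ (ψ.realize v)ᶜ := by
  have := Fintype.ofFinite X
  refine le_compl (eq_bot_of_inf_minterm v Finset.univ _ fun s => ?_)
  have hm : ∀ x, (s x = ⊤ → minterm v Finset.univ s ≤ (v x)ᶜᶜ) ∧
      (s x = ⊥ → minterm v Finset.univ s ≤ (v x)ᶜ) := by
    intro x
    have hx : minterm v Finset.univ s ≤ _ := Finset.inf_le (Finset.mem_univ x)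
    constructor
    · intro hs
      rw [if_pos hs] at hx
      exact hx.trans (le_compl_compl _)
    · intro hs
      rwa [if_neg (hs ▸ BPrime.bot_ne_top)] at hx
  rcases BPrime.eq_bot_or_eq_top (φ.realize s) with hs | hs
  · have hψ := (le_compl_of_realize_two v s _ hm ψ).2 (h s ▸ hs)
    refine le_bot_iff.1 ?_
    calc _ ≤ ψ.realize v ⊓ (ψ.realize v)ᶜ := inf_le_inf inf_le_right hψ
      _ = ⊥ := inf_compl_self _
  · have hφ := (le_compl_of_realize_two v s _ hm φ).1 hs
    refine le_bot_iff.1 ?_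
    calc _ ≤ (φ.realize v)ᶜ ⊓ (φ.realize v)ᶜᶜ := inf_le_inf inf_le_left hφ
      _ = ⊥ := inf_compl_self _

/-- The subalgebra generated by finitely many elements is finite: it is contained in the
sublattice generated by the generators and the finitely many values of negated terms. -/
theorem finite_range_realize [Finite X] (v : X → A) :
    (Set.range fun φ : pLang.Term X => φ.realize v).Finite := by
  have hN : (Set.range fun φ : pLang.Term X => (φ.realize v)ᶜ).Finite := by
    have hfac : Function.FactorsThrough (fun φ : pLang.Term X => (φ.realize v)ᶜ)
        (fun φ (s : X → BPrime 0) => φ.realize s) := fun φ ψ h =>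
      le_antisymm (compl_realize_le v fun s => congrFun h s)
        (compl_realize_le v fun s => (congrFun h s).symm)
    have : Nonempty A := ⟨⊥⟩
    obtain ⟨e, he⟩ := (Function.factorsThrough_iff _).1 hfac
    have : Finite (BPrime 0) := inferInstanceAs (Finite (Option (Set (Fin 0))))
    rw [he]
    exact (Set.finite_range e).subset (Set.range_comp_subset_range _ _)
  refine (((Set.finite_range v).union hN).union (Set.toFinite {⊥, ⊤})).latticeClosure.subset ?_
  rintro _ ⟨φ, rfl⟩
  have hsub := subset_latticeClosure (s := (Set.range v ∪
    Set.range fun φ : pLang.Term X => (φ.realize v)ᶜ) ∪ {⊥, ⊤})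
  have hlat := isSublattice_latticeClosure (s := (Set.range v ∪
    Set.range fun φ : pLang.Term X => (φ.realize v)ᶜ) ∪ {⊥, ⊤})
  induction φ using pTerm_induction with
  | var x => exact hsub (Or.inl (Or.inl ⟨x, rfl⟩))
  | bot => exact hsub (Or.inr (by simp))
  | top => exact hsub (Or.inr (by simp))
  | neg φ ih => exact hsub (Or.inl (Or.inr ⟨φ, (realize_negT v φ).symm⟩))
  | inf φ ψ ih ih' =>
    have := hlat.2 ih ih'
    simpa only [realize_infT] using this
  | sup φ ψ ih ih' =>
    have := hlat.1 ih ih'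
    simpa only [realize_supT] using this

end LocallyFinite

theorem locallyFiniteClass_PDL : LocallyFiniteClass PDL.{u} := by
  intro A _ hA hfg
  obtain ⟨inst, model⟩ := hA.exists_isModel
  obtain ⟨n, s, hs⟩ := Substructure.fg_iff_exists_fin_generating_family.1 hfg.1
  refine Set.finite_univ_iff.1 ((finite_range_realize s).subset fun a _ => ?_)
  have ha : a ∈ Substructure.closure pLang (Set.range s) := hs ▸ Substructure.mem_top a
  obtain ⟨t, rfl⟩ := Substructure.mem_closure_iff_exists_term.1 ha
  choose f hf using fun x : Set.range s => x.2
  refine ⟨t.relabel f, ?_⟩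
  simp only [Term.realize_relabel]
  congr 1
  exact funext hf

theorem LocallyFiniteClass.mono {L : FirstOrder.Language.{0, 0}} {K K' : AlgClass.{u} L}
    (h : LocallyFiniteClass K') (hK : ∀ (A : Type u) [L.Structure A], K A → K' A) :
    LocallyFiniteClass K :=
  fun A _ hA => h A (hK A hA)

/-! ### Finiteness of the set of kernels -/

/-- There is a pseudocomplemented distributive lattice with a valuation under which only
equivalent terms agree: a product of refutations of all the identities that are not valid. -/
theorem exists_generic_valuation (X : Type) :
    ∃ (A : Type u) (_ : pLang.Structure A) (_ : PDL A) (v : X → A),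
      ∀ φ ψ : pLang.Term X, φ.realize v = ψ.realize v → ClassValid PDL.{u} φ ψ := by
  have key : ∀ e : {e : pLang.Term X × pLang.Term X // ¬ ClassValid PDL.{u} e.1 e.2},
      ∃ (A : Type u) (_ : pLang.Structure A) (_ : PDL A) (v : X → A),
        e.1.1.realize v ≠ e.1.2.realize v := by
    rintro ⟨e, he⟩
    simp only [ClassValid, Valid, not_forall] at he
    obtain ⟨A, i, hA, v, hv⟩ := he
    exact ⟨A, i, hA, v, hv⟩
  choose A i hA v hv using key
  refine ⟨∀ e : ULift.{u} {e : pLang.Term X × pLang.Term X // ¬ ClassValid PDL.{u} e.1 e.2},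
    A e.down, inferInstance, PDL.pi _ fun e => hA e.down, fun x e => v e.down x, ?_⟩
  intro φ ψ h
  by_contra hne
  refine hv ⟨(φ, ψ), hne⟩ ?_
  have := congrFun h ⟨⟨(φ, ψ), hne⟩⟩
  rwa [realize_pi, realize_pi] at this

section Class

variable {L : FirstOrder.Language.{0, 0}} {K : AlgClass.{u} L} {α β : Type}

theorem ClassValid.symm {φ ψ : L.Term α} (h : ClassValid K φ ψ) : ClassValid K ψ φ :=
  fun A _ hA v => (h A hA v).symm

theorem ClassValid.trans {φ ψ χ : L.Term α} (h : ClassValid K φ ψ) (h' : ClassValid K ψ χ) :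
    ClassValid K φ χ :=
  fun A _ hA v => (h A hA v).trans (h' A hA v)

theorem ClassValid.subst {φ ψ : L.Term α} (h : ClassValid K φ ψ) (σ : α → L.Term β) :
    ClassValid K (φ.subst σ) (ψ.subst σ) := fun A _ hA v => by
  rw [Term.realize_subst, Term.realize_subst]
  exact h A hA _

theorem LessGeneral.trans {X : Finset ℕ} {σ₁ σ₂ σ₃ : Substitution L X}
    (h : LessGeneral K σ₁ σ₂) (h' : LessGeneral K σ₂ σ₃) : LessGeneral K σ₁ σ₃ := by
  obtain ⟨τ, hτ⟩ := h
  obtain ⟨τ', hτ'⟩ := h'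
  refine ⟨fun n => (τ' n).subst τ, fun x A _ hA v => ?_⟩
  rw [← hτ x A hA v, Term.realize_subst, Term.realize_subst, ← hτ' x A hA, Term.realize_subst]
  simp only [Term.realize_subst]

end Class

theorem finite_range_kernel {K : AlgClass.{u} pLang}
    (hK : ∀ (A : Type u) [pLang.Structure A], K A → PDL A) (X : Finset ℕ) :
    (Set.range fun σ : Substitution pLang X => kernel K σ).Finite := by
  obtain ⟨A, _, hA, v, hv⟩ := exists_generic_valuation.{u} X
  obtain ⟨_, _⟩ := hA.exists_isModel
  -- `ρ` picks a representative of each of the finitely many classes of equivalent terms.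
  choose g hg using fun a : Set.range fun φ : pLang.Term X => φ.realize v => a.2
  let ρ : pLang.Term X → pLang.Term X := fun φ => g ⟨φ.realize v, φ, rfl⟩
  have hρ : ∀ φ, ClassValid K (ρ φ) φ := fun φ B _ hB =>
    hv _ _ (hg ⟨φ.realize v, φ, rfl⟩) B (hK B hB)
  have hfin : (Set.range ρ).Finite := by
    have := (finite_range_realize v).to_subtype
    exact (Set.finite_range g).subset (by rintro _ ⟨φ, rfl⟩; exact ⟨_, rfl⟩)
  refine ((hfin.prod hfin).powerset.image
    fun T => {e : pLang.Term X × pLang.Term X | (ρ e.1, ρ e.2) ∈ T}).subset ?_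
  rintro _ ⟨σ, rfl⟩
  refine ⟨kernel K σ ∩ Set.range ρ ×ˢ Set.range ρ, Set.inter_subset_right, ?_⟩
  ext ⟨φ, ψ⟩
  simp only [Set.mem_ofPred_eq, Set.mem_inter_iff, Set.mem_prod, Set.mem_range_self, and_self,
    and_true, kernel]
  exact ⟨fun h => (((hρ φ).subst σ).symm.trans h).trans ((hρ ψ).subst σ),
    fun h => (((hρ φ).subst σ).trans h).trans ((hρ ψ).subst σ).symm⟩

theorem finite_range_kernel_unifiers {K : AlgClass.{u} pLang}
    (hK : ∀ (A : Type u) [pLang.Structure A], K A → PDL A) (S : Identities pLang) :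
    (Set.range fun σ : Unifiers K S => kernel K σ.1).Finite :=
  (finite_range_kernel hK (vars S)).subset (by rintro _ ⟨σ, rfl⟩; exact ⟨σ.1, rfl⟩)

/-! ### Stone algebras -/

section Stone

open PseudocomplLattice

variable {A : Type*} [PseudocomplLattice A]

open Classical in
/-- The map to the three-element chain `B_1'` given by a prime ideal `J` (whose complement is a
prime filter): `⊤` on the prime filter, the middle element on the rest of the maximal filter above
it, and `⊥` elsewhere. -/
noncomputable def stoneMap (J : Order.Ideal A) (a : A) : BPrime 1 :=
  if a ∉ J then ⊤ else if aᶜ ∈ J then ((Set.univ : Set (Fin 1)) : BPrime 1) else ⊥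

theorem stoneMap_eq_top_iff {J : Order.Ideal A} {a : A} : stoneMap J a = ⊤ ↔ a ∉ J := by
  unfold stoneMap
  split_ifs <;> simp_all

theorem BPrime.compl_univ {n : ℕ} [NeZero n] : ((Set.univ : Set (Fin n)) : BPrime n)ᶜ = ⊥ := by
  rw [BPrime.compl_coe ⟨0, Set.mem_univ _⟩, Set.compl_univ]
  rfl

theorem BPrime.compl_eq_bot_or_eq_top (a : BPrime 1) : aᶜ = ⊥ ∨ aᶜ = ⊤ := by
  induction a using WithTop.recTopCoe with
  | top => exact Or.inl compl_top
  | coe s =>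
    rcases s.eq_empty_or_nonempty with rfl | hs
    · exact Or.inr compl_bot
    · rw [Subsingleton.eq_univ_of_nonempty hs]
      exact Or.inl BPrime.compl_univ

theorem realize_stoneMap [pLang.Structure A] [IsModel A] (hA : ∀ a : A, aᶜ ⊔ aᶜᶜ = ⊤)
    {J : Order.Ideal A} (hJ : J.IsPrime) {α : Type} (v : α → A) (φ : pLang.Term α) :
    stoneMap J (φ.realize v) = φ.realize (stoneMap J ∘ v) := by
  have htop : (⊤ : A) ∉ J := fun h =>
    hJ.toIsProper.ne_univ (Set.eq_univ_of_forall fun a => J.lower le_top h)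
  have hinf : ∀ a b, a ⊓ b ∈ J ↔ a ∈ J ∨ b ∈ J := fun a b =>
    ⟨hJ.mem_or_mem, fun h => h.elim (J.lower inf_le_left) (J.lower inf_le_right)⟩
  have hsup : ∀ a b, a ⊔ b ∈ J ↔ a ∈ J ∧ b ∈ J := fun a b => Order.Ideal.sup_mem_iff
  -- Exactly one of `aᶜ` and `aᶜᶜ` lies in `J`, by the Stone identity.
  have hcc : ∀ a : A, aᶜᶜ ∈ J ↔ aᶜ ∉ J := fun a => by
    refine ⟨fun h h' => htop (hA a ▸ (hsup _ _).2 ⟨h', h⟩), fun h => ?_⟩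
    exact ((hinf _ _).1 (by rw [PseudocomplLattice.inf_compl_self]; exact J.bot_mem)).resolve_left h
  have hc : ∀ a : A, a ∉ J → aᶜ ∈ J := fun a h =>
    ((hinf _ _).1 (by rw [PseudocomplLattice.inf_compl_self]; exact J.bot_mem)).resolve_left h
  have hcinf : ∀ a b : A, (a ⊓ b)ᶜ ∈ J ↔ aᶜ ∈ J ∧ bᶜ ∈ J := fun a b => by
    rw [← not_iff_not, ← hcc, compl_compl_inf, hinf, hcc, hcc]
    tauto
  have hcsup : ∀ a b : A, (a ⊔ b)ᶜ ∈ J ↔ aᶜ ∈ J ∨ bᶜ ∈ J := fun a b => by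
    rw [compl_sup_eq, hinf]
  have hmc := BPrime.compl_univ (n := 1)
  refine map_realize (stoneMap J) ?_ ?_ ?_ ?_ ?_ v φ
  · simp [stoneMap, htop]
  · simp [stoneMap, htop]
  · intro a
    have := hc a
    have := hcc a
    by_cases h1 : a ∈ J <;> by_cases h2 : aᶜ ∈ J <;> simp_all [stoneMap]
  · intro a b
    have := hc a
    have := hc b
    by_cases h1 : a ∈ J <;> by_cases h2 : b ∈ J <;> by_cases h3 : aᶜ ∈ J <;>
      by_cases h4 : bᶜ ∈ J <;> simp_all [stoneMap]
  · intro a b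
    have := hc a
    have := hc b
    by_cases h1 : a ∈ J <;> by_cases h2 : b ∈ J <;> by_cases h3 : aᶜ ∈ J <;>
      by_cases h4 : bᶜ ∈ J <;> simp_all [stoneMap]

/-- In a distributive lattice, `a ≤ b` holds as soon as no prime ideal contains `b` but not `a`. -/
theorem le_of_forall_prime_ideal {a b : A}
    (h : ∀ J : Order.Ideal A, J.IsPrime → b ∈ J → a ∈ J) : a ≤ b := by
  by_contra hab
  have hdisj : Disjoint (Order.PFilter.principal a : Set A) (Order.Ideal.principal b : Set A) :=
    Set.disjoint_left.2 fun c hc hc' => hab (le_trans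
      (Order.PFilter.mem_principal.1 hc) (Order.Ideal.mem_principal.1 hc'))
  obtain ⟨J, hJ, hbJ, haJ⟩ := DistribLattice.prime_ideal_of_disjoint_filter_ideal hdisj
  exact Set.disjoint_left.1 haJ (Order.PFilter.mem_principal.2 le_rfl)
    (h J hJ (hbJ (Order.Ideal.mem_principal.2 le_rfl)))

end Stone

theorem stoneAlg_iff_bVar_one (A : Type u) [pLang.Structure A] : StoneAlg A ↔ BVar 1 A := by
  constructor
  · rintro ⟨hA, hst⟩
    refine ⟨hA, fun φ ψ h v => ?_⟩
    obtain ⟨_, _⟩ := hA.exists_isModel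
    simp only [pSup_eq, pNeg_eq, pTop_eq] at hst
    have key : ∀ J : Order.Ideal A, J.IsPrime → (φ.realize v ∈ J ↔ ψ.realize v ∈ J) := by
      intro J hJ
      rw [← not_iff_not, ← stoneMap_eq_top_iff, ← stoneMap_eq_top_iff, realize_stoneMap hst hJ,
        realize_stoneMap hst hJ, h]
    exact le_antisymm (le_of_forall_prime_ideal fun J hJ => (key J hJ).2)
      (le_of_forall_prime_ideal fun J hJ => (key J hJ).1)
  · rintro ⟨hA, h⟩
    refine ⟨hA, fun a => ?_⟩
    obtain ⟨_, _⟩ := hA.exists_isModel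
    have hv : Valid (BPrime 1) (tSup (tNeg tX) (tNeg (tNeg tX))) tTop := by
      intro v
      simp only [realize_tSup, realize_tNeg, realize_tTop]
      rcases BPrime.compl_eq_bot_or_eq_top (tX.realize v) with h | h <;> simp [h]
    have := h _ _ hv fun _ => a
    simpa [pSup_eq, pNeg_eq, pTop_eq, tX] using this

theorem stoneAlg_eq_bVar_one : StoneAlg.{u} = BVar.{u} 1 := by
  funext A _
  exact propext (stoneAlg_iff_bVar_one A)

/-! ### Validity in the classes -/

theorem bVar_ulift (n : ℕ) : BVar n (ULift.{u} (BPrime n)) :=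
  ⟨(BPrime.pdl n).ulift, fun φ ψ h => (valid_ulift_iff φ ψ).2 h⟩

/-- The algebra `B_n'`, lifted to `Type u`, is a member of `𝔅_n` and generates it. -/
theorem classValid_bVar_iff {n : ℕ} {φ ψ : pLang.Term ℕ} :
    ClassValid (BVar.{u} n) φ ψ ↔ Valid (BPrime n) φ ψ :=
  ⟨fun h => (valid_ulift_iff φ ψ).1 (h _ (bVar_ulift n)), fun h _ _ hA => hA.2 φ ψ h⟩

/-! ### Substitutions -/

section Substitution

variable {L : FirstOrder.Language.{0, 0}}

theorem realize_congr {A : Type*} [L.Structure A] {α : Type} [DecidableEq α] {v w : α → A}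
    (φ : L.Term α) (h : ∀ x ∈ φ.varFinset, v x = w x) : φ.realize v = φ.realize w := by
  induction φ with
  | var x => exact h x (Finset.mem_singleton_self x)
  | func f ts ih =>
    simp only [Term.realize_func]
    refine congrArg _ (funext fun i => ih i fun x hx => h x ?_)
    exact Finset.mem_biUnion.2 ⟨i, Finset.mem_univ i, hx⟩

/-- Solving `S` in `A` under the valuation induced by a substitution: only the values at the
variables of `S` matter. -/
theorem valid_app_iff {A : Type*} [L.Structure A] {S : Identities L}
    {σ : Substitution L (vars S)} {e : L.Term ℕ × L.Term ℕ} (he : e ∈ S) :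
    Valid A (σ.app e.1) (σ.app e.2) ↔ ∀ v w : ℕ → A,
      (∀ x : vars S, w x = (σ x).realize v) → e.1.realize w = e.2.realize w := by
  have hsub : e.1.varFinset ∪ e.2.varFinset ⊆ vars S :=
    Finset.subset_biUnion_of_mem (fun e : L.Term ℕ × L.Term ℕ => e.1.varFinset ∪ e.2.varFinset) he
  have key : ∀ (φ : L.Term ℕ) (v w : ℕ → A), φ.varFinset ⊆ vars S →
      (∀ x : vars S, w x = (σ x).realize v) → (σ.app φ).realize v = φ.realize w := by
    intro φ v w hφ hw
    rw [Substitution.app, Term.realize_subst]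
    refine realize_congr φ fun x hx => ?_
    rw [dif_pos (hφ hx), ← hw ⟨x, hφ hx⟩]
  have h1 := Finset.union_subset_left hsub
  have h2 := Finset.union_subset_right hsub
  constructor
  · intro h v w hw
    rw [← key _ v w h1 hw, ← key _ v w h2 hw]
    exact h v
  · intro h v
    let w : ℕ → A := fun n => if hn : n ∈ vars S then (σ ⟨n, hn⟩).realize v else v n
    have hw : ∀ x : vars S, w x = (σ x).realize v := fun x => dif_pos x.2
    rw [key _ v w h1 hw, key _ v w h2 hw]
    exact h v w hw

variable {K : AlgClass.{u} L}

theorem LessExact.trans {X : Finset ℕ} {σ₁ σ₂ σ₃ : Substitution L X}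
    (h : LessExact K σ₁ σ₂) (h' : LessExact K σ₂ σ₃) : LessExact K σ₁ σ₃ :=
  Set.Subset.trans h' h

theorem LessGeneral.lessExact {X : Finset ℕ} {σ₁ σ₂ : Substitution L X}
    (h : LessGeneral K σ₂ σ₁) : LessExact K σ₂ σ₁ := by
  obtain ⟨τ, hτ⟩ := h
  intro e he A _ hA v
  have := he A hA fun n => (τ n).realize v
  simp only [Term.realize_subst] at this ⊢
  have hv : (fun x => (σ₁ x).realize fun n => (τ n).realize v) = fun x => (σ₂ x).realize v :=
    funext fun x => by rw [← hτ x A hA v, Term.realize_subst]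
  rwa [hv] at this

end Substitution

/-! ### Exact type of Stone algebras -/

section ExactStone

variable {X : Finset ℕ}

/-- The substitution `x ↦ (¬y ∧ σ₁(x)) ∨ (¬¬y ∧ σ₂(x))`, where `y` is the variable `0` and the
variables of `σ₁` and `σ₂` are shifted by one in order to make `y` fresh. -/
def booleanMix (σ₁ σ₂ : Substitution pLang X) : Substitution pLang X := fun x =>
  supT (infT (negT (Term.var 0)) ((σ₁ x).relabel Nat.succ))
    (infT (negT (negT (Term.var 0))) ((σ₂ x).relabel Nat.succ))

theorem lessGeneral_booleanMix {K : AlgClass.{u} pLang}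
    (hK : ∀ (A : Type u) [pLang.Structure A], K A → PDL A) (σ₁ σ₂ : Substitution pLang X) :
    LessGeneral K σ₁ (booleanMix σ₁ σ₂) ∧ LessGeneral K σ₂ (booleanMix σ₁ σ₂) := by
  refine ⟨⟨fun n => n.casesOn botT Term.var, fun x A _ hA v => ?_⟩,
    ⟨fun n => n.casesOn topT Term.var, fun x A _ hA v => ?_⟩⟩ <;>
  · obtain ⟨_, _⟩ := (hK A hA).exists_isModel
    simp [booleanMix, Term.realize_subst, Function.comp_def]

/-- In `B_1'` the value of `¬y` is `⊥` or `⊤`, so that under each valuation `booleanMix σ₁ σ₂`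
takes the values of `σ₁` or those of `σ₂`. -/
theorem isUnifier_booleanMix {S : Identities pLang} {σ₁ σ₂ : Substitution pLang (vars S)}
    (h₁ : IsUnifier (BVar.{u} 1) S σ₁) (h₂ : IsUnifier (BVar.{u} 1) S σ₂) :
    IsUnifier (BVar.{u} 1) S (booleanMix σ₁ σ₂) := by
  intro e he
  have h₁ := (valid_app_iff he).1 (classValid_bVar_iff.1 (h₁ e he))
  have h₂ := (valid_app_iff he).1 (classValid_bVar_iff.1 (h₂ e he))
  refine classValid_bVar_iff.2 ((valid_app_iff he).2 fun v w hw => ?_)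
  rcases BPrime.compl_eq_bot_or_eq_top (v 0) with h | h
  · exact h₂ (v ∘ Nat.succ) w fun x => by simp [hw, booleanMix, h]
  · exact h₁ (v ∘ Nat.succ) w fun x => by simp [hw, booleanMix, h]

/-- Any two unifiers have a common upper bound and there are finitely many kernels. -/
theorem hasExactType_bVar_one : HasExactType (BVar.{u} 1) .unitary := by
  have hK : ∀ (A : Type u) [pLang.Structure A], BVar 1 A → PDL A := fun _ _ h => h.1
  have hgr : ∀ S : Identities pLang, Nonempty (Unifiers (BVar.{u} 1) S) →
      ∃ g : Unifiers (BVar.{u} 1) S, ∀ σ : Unifiers (BVar.{u} 1) S,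
        LessExact (BVar.{u} 1) σ.1 g.1 := by
    intro S _
    refine exists_greatest_of_directed (finite_range_kernel_unifiers hK S) (fun _ _ => Iff.rfl)
      fun σ₁ σ₂ => ⟨⟨booleanMix σ₁.1 σ₂.1, isUnifier_booleanMix σ₁.2 σ₂.2⟩, ?_⟩
    have := lessGeneral_booleanMix hK σ₁.1 σ₂.1
    exact ⟨this.1.lessExact, this.2.lessExact⟩
  constructor
  · have : Nonempty (Unifiers (BVar.{u} 1) ∅) :=
      ⟨⟨fun _ => botT, fun e he => absurd he (Finset.notMem_empty e)⟩⟩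
    obtain ⟨g, hg⟩ := hgr ∅ this
    exact ⟨∅, this, hasType_unitary_of_greatest hg⟩
  · rintro s ⟨S, hS, hs⟩
    obtain ⟨g, hg⟩ := hgr S hS
    refine (HasType.eq_unitary_of_greatest ?_ hg hs).le
    exact fun x y z h h' => LessExact.trans h h'

end ExactStone

/-! ### The clause `{x ∨ ¬x ≈ ⊤} ⇒ {x ≈ ⊤, ¬x ≈ ⊤}` -/

section Clause

open PseudocomplLattice

open Classical in
/-- The two-valued homomorphism given by an atom `c`: it sends the elements above `c` to `⊤`. -/
noncomputable def atomMap {A : Type*} [PseudocomplLattice A] (c a : A) : BPrime 0 :=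
  if c ≤ a then ⊤ else ⊥

theorem realize_atomMap {A : Type*} [PseudocomplLattice A] [pLang.Structure A] [IsModel A]
    {c : A} (hc : IsAtom c) {α : Type} (v : α → A) (φ : pLang.Term α) :
    atomMap c (φ.realize v) = φ.realize (atomMap c ∘ v) := by
  have hd : ∀ a, ¬ c ≤ a ↔ c ⊓ a = ⊥ := fun a => by
    rw [← disjoint_iff, ← not_iff_not, not_not]
    exact hc.not_disjoint_iff_le.symm
  have hcompl : ∀ a, c ≤ aᶜ ↔ ¬ c ≤ a := fun a => by rw [hd, le_compl_iff]
  have hsup : ∀ a b, c ≤ a ⊔ b ↔ c ≤ a ∨ c ≤ b := fun a b => by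
    rw [← not_iff_not, not_or, hd, hd, hd, inf_sup_left, sup_eq_bot_iff]
  refine map_realize (atomMap c) ?_ ?_ ?_ ?_ ?_ v φ
  · simp [atomMap, hc.1]
  · simp [atomMap]
  · intro a
    by_cases h : c ≤ a <;> simp [atomMap, hcompl, h]
  · intro a b
    by_cases h : c ≤ a <;> by_cases h' : c ≤ b <;> simp [atomMap, h, h']
  · intro a b
    by_cases h : c ≤ a <;> by_cases h' : c ≤ b <;> simp [atomMap, hsup, h, h']

theorem BPrime.isAtom_singleton {n : ℕ} (i : Fin n) : IsAtom (({i} : Set (Fin n)) : BPrime n) := by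
  refine ⟨fun h => (Set.singleton_nonempty i).ne_empty (WithTop.coe_injective h), fun a ha => ?_⟩
  induction a using WithTop.recTopCoe with
  | top => exact absurd ha not_top_lt
  | coe s =>
    rw [WithTop.coe_lt_coe, Set.ssubset_singleton_iff] at ha
    rw [ha, BPrime.bot_eq]

/-- The only complemented elements of `B_n'` are its bounds. -/
theorem BPrime.eq_of_sup_compl_eq_top {n : ℕ} {a : BPrime n} (h : a ⊔ aᶜ = ⊤) : a = ⊤ ∨ a = ⊥ := by
  induction a using WithTop.recTopCoe with
  | top => exact Or.inl rfl
  | coe s =>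
    rcases s.eq_empty_or_nonempty with rfl | hs
    · exact Or.inr rfl
    · rw [BPrime.compl_coe hs, ← WithTop.coe_sup] at h
      exact absurd h (WithTop.coe_ne_top)

/-- Two two-valued valuations are the images of a single valuation in `B_n'`, `n ≥ 2`, under the
homomorphisms given by two atoms; so a term that is complemented in `B_n'` has the same value under
both of them. -/
theorem two_valued_constant {n : ℕ} (hn : 2 ≤ n) {φ : pLang.Term ℕ}
    (h : Valid (BPrime n) (tSup φ (tNeg φ)) tTop) :
    (∀ s : ℕ → BPrime 0, φ.realize s = ⊤) ∨ ∀ s : ℕ → BPrime 0, φ.realize s = ⊥ := by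
  by_contra! hne
  obtain ⟨⟨s, hs⟩, t, ht⟩ := hne
  have hs := (BPrime.eq_bot_or_eq_top _).resolve_right hs
  have ht := (BPrime.eq_bot_or_eq_top _).resolve_left ht
  let i₀ : Fin n := ⟨0, by lia⟩
  let i₁ : Fin n := ⟨1, by lia⟩
  have hi : i₁ ≠ i₀ := by simp [i₀, i₁]
  let v : ℕ → BPrime n := fun x =>
    ({i | (i = i₀ ∧ s x = ⊤) ∨ (i = i₁ ∧ t x = ⊤)} : Set (Fin n))
  have hv₀ : atomMap (({i₀} : Set (Fin n)) : BPrime n) ∘ v = s := by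
    funext x
    have : (({i₀} : Set (Fin n)) : BPrime n) ≤ v x ↔ s x = ⊤ := by
      simp [v, hi.symm]
    rcases BPrime.eq_bot_or_eq_top (s x) with hx | hx <;> simp [atomMap, this, hx]
  have hv₁ : atomMap (({i₁} : Set (Fin n)) : BPrime n) ∘ v = t := by
    funext x
    have : (({i₁} : Set (Fin n)) : BPrime n) ≤ v x ↔ t x = ⊤ := by
      simp [v, hi]
    rcases BPrime.eq_bot_or_eq_top (t x) with hx | hx <;> simp [atomMap, this, hx]
  have h₀ := realize_atomMap (BPrime.isAtom_singleton i₀) v φ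
  have h₁ := realize_atomMap (BPrime.isAtom_singleton i₁) v φ
  rw [hv₀, hs] at h₀
  rw [hv₁, ht] at h₁
  have := h v
  rw [realize_tSup, realize_tNeg, realize_tTop] at this
  rcases BPrime.eq_of_sup_compl_eq_top this with h' | h'
  · rw [h'] at h₀
    simp [atomMap, BPrime.bot_ne_top.symm] at h₀
  · rw [h'] at h₁
    simp [atomMap, (BPrime.isAtom_singleton i₁).1] at h₁

variable {A : Type*} [PseudocomplLattice A] [pLang.Structure A] [IsModel A]

/-- A two-valued tautology takes dense values. -/
theorem compl_realize_eq_bot {φ : pLang.Term ℕ} (h : ∀ s : ℕ → BPrime 0, φ.realize s = ⊤)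
    (v : ℕ → A) : (φ.realize v)ᶜ = ⊥ := by
  have key := compl_realize_le (fun x : φ.varFinset => v x) (φ := φ.restrictVar id) (ψ := topT)
    fun s => by
      let t : ℕ → BPrime 0 := fun n => if hn : n ∈ φ.varFinset then s ⟨n, hn⟩ else ⊥
      rw [Term.realize_restrictVar t fun x => by simp [t], h, realize_topT]
  have hv : (φ.restrictVar id).realize (fun x : φ.varFinset => v x) = φ.realize v :=
    Term.realize_restrictVar v fun _ => rfl
  rw [hv] at key
  simpa using key

/-- A complemented term is valid or has a valid negation. Validity in `K` need not be determined by
`B_n'`; the term or its negation is a two-valued tautology, hence dense, and complemented dense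
elements are `⊤`. -/
theorem classValid_or_of_complemented {n : ℕ} (hn : 2 ≤ n) {K : AlgClass.{u} pLang}
    (hK : ∀ (A : Type u) [pLang.Structure A], K A → PDL A)
    (hB : ∀ φ ψ : pLang.Term ℕ, ClassValid K φ ψ → Valid (BPrime n) φ ψ) {φ : pLang.Term ℕ}
    (h : ClassValid K (tSup φ (tNeg φ)) tTop) :
    ClassValid K φ tTop ∨ ClassValid K (tNeg φ) tTop := by
  rcases two_valued_constant hn (hB _ _ h) with h' | h'
  · refine Or.inl fun A _ hA v => ?_
    obtain ⟨_, _⟩ := (hK A hA).exists_isModel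
    simpa [compl_realize_eq_bot h' v] using h A hA v
  · refine Or.inr fun A _ hA v => ?_
    obtain ⟨_, _⟩ := (hK A hA).exists_isModel
    have := compl_realize_eq_bot (φ := tNeg φ) (fun s => by simp [h']) v
    rw [realize_tNeg] at this ⊢
    rw [← compl_triple, this, PseudocomplLattice.compl_bot, realize_tTop]

end Clause

/-! ### Admissibility and finitary exact type -/

section ClauseAdmissible

variable {K : AlgClass.{u} pLang}

theorem app_tX {X : Finset ℕ} (σ : Substitution pLang X) (h0 : 0 ∈ X) :
    σ.app tX = σ ⟨0, h0⟩ := by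
  simp [Substitution.app, tX, h0]

theorem app_tTop {X : Finset ℕ} (σ : Substitution pLang X) : σ.app tTop = tTop :=
  congrArg (Term.func _) (funext fun i => i.elim0)

theorem app_tNeg {X : Finset ℕ} (σ : Substitution pLang X) (φ : pLang.Term ℕ) :
    σ.app (tNeg φ) = tNeg (σ.app φ) :=
  congrArg (Term.func _) (funext fun i => by fin_cases i; rfl)

theorem app_tSup {X : Finset ℕ} (σ : Substitution pLang X) (φ ψ : pLang.Term ℕ) :
    σ.app (tSup φ ψ) = tSup (σ.app φ) (σ.app ψ) :=
  congrArg (Term.func _) (funext fun i => by fin_cases i <;> rfl)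

theorem isUnifier_idLEM_iff {X : Finset ℕ} (σ : Substitution pLang X) (h0 : 0 ∈ X) :
    IsUnifier K {idLEM} σ ↔
      ClassValid K (tSup (σ ⟨0, h0⟩) (tNeg (σ ⟨0, h0⟩))) tTop := by
  simp only [IsUnifier, Finset.mem_singleton, forall_eq, idLEM]
  rw [app_tSup, app_tNeg, app_tX σ h0, app_tTop]

theorem isUnifier_idX_iff {X : Finset ℕ} (σ : Substitution pLang X) (h0 : 0 ∈ X) :
    IsUnifier K {idX} σ ↔ ClassValid K (σ ⟨0, h0⟩) tTop := by
  simp only [IsUnifier, Finset.mem_singleton, forall_eq, idX]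
  rw [app_tX σ h0, app_tTop]

theorem isUnifier_idNegX_iff {X : Finset ℕ} (σ : Substitution pLang X) (h0 : 0 ∈ X) :
    IsUnifier K {idNegX} σ ↔ ClassValid K (tNeg (σ ⟨0, h0⟩)) tTop := by
  simp only [IsUnifier, Finset.mem_singleton, forall_eq, idNegX]
  rw [app_tNeg, app_tX σ h0, app_tTop]

theorem zero_mem_vars_idLEM : 0 ∈ vars {idLEM} := by
  simp [vars, idLEM, tSup, tX, Fin.exists_fin_two]

variable {n : ℕ}

theorem not_classValid_of_realize_eq_bot {φ : pLang.Term ℕ}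
    (hB : ∀ φ ψ : pLang.Term ℕ, ClassValid K φ ψ → Valid (BPrime n) φ ψ)
    (h : φ.realize (fun _ => (⊥ : BPrime n)) = ⊥) : ¬ ClassValid K φ tTop := fun hc => by
  have := hB _ _ hc fun _ => ⊥
  rw [h, realize_tTop] at this
  exact BPrime.bot_ne_top this

theorem classValid_lem_botT (hK : ∀ (A : Type u) [pLang.Structure A], K A → PDL A) :
    ClassValid K (tSup botT (tNeg botT)) tTop := fun A _ hA v => by
  obtain ⟨_, _⟩ := (hK A hA).exists_isModel
  simp

theorem classValid_lem_tTop (hK : ∀ (A : Type u) [pLang.Structure A], K A → PDL A) :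
    ClassValid K (tSup tTop (tNeg tTop)) tTop := fun A _ hA v => by
  obtain ⟨_, _⟩ := (hK A hA).exists_isModel
  simp

theorem admissible_idLEM (hn : 2 ≤ n)
    (hK : ∀ (A : Type u) [pLang.Structure A], K A → PDL A)
    (hB : ∀ φ ψ : pLang.Term ℕ, ClassValid K φ ψ → Valid (BPrime n) φ ψ) :
    Admissible K {idLEM} idXOrNegX := by
  intro σ hσ
  have h0 : 0 ∈ vars {idLEM} ∪ vars idXOrNegX := Finset.mem_union_left _ zero_mem_vars_idLEM
  rcases classValid_or_of_complemented hn hK hB ((isUnifier_idLEM_iff σ h0).1 hσ) with h | h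
  · exact ⟨idX, by simp [idXOrNegX], (isUnifier_idX_iff σ h0).2 h⟩
  · exact ⟨idNegX, by simp [idXOrNegX], (isUnifier_idNegX_iff σ h0).2 h⟩

theorem not_admissible_idX (hK : ∀ (A : Type u) [pLang.Structure A], K A → PDL A)
    (hB : ∀ φ ψ : pLang.Term ℕ, ClassValid K φ ψ → Valid (BPrime n) φ ψ) :
    ¬ Admissible K {idLEM} {idX} := by
  intro h
  have h0 : 0 ∈ vars {idLEM} ∪ vars {idX} := Finset.mem_union_left _ zero_mem_vars_idLEM
  obtain ⟨e, he, h⟩ := h (fun _ => botT) ((isUnifier_idLEM_iff _ h0).2 (classValid_lem_botT hK))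
  rw [Finset.mem_singleton.1 he, isUnifier_idX_iff _ h0] at h
  exact not_classValid_of_realize_eq_bot hB (by simp) h

theorem not_admissible_idNegX (hK : ∀ (A : Type u) [pLang.Structure A], K A → PDL A)
    (hB : ∀ φ ψ : pLang.Term ℕ, ClassValid K φ ψ → Valid (BPrime n) φ ψ) :
    ¬ Admissible K {idLEM} {idNegX} := by
  intro h
  have h0 : 0 ∈ vars {idLEM} ∪ vars {idNegX} := Finset.mem_union_left _ zero_mem_vars_idLEM
  obtain ⟨e, he, h⟩ := h (fun _ => tTop) ((isUnifier_idLEM_iff _ h0).2 (classValid_lem_tTop hK))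
  rw [Finset.mem_singleton.1 he, isUnifier_idNegX_iff _ h0] at h
  exact not_classValid_of_realize_eq_bot hB (by simp) h

/-- The unifiers `x ↦ ⊥` and `x ↦ ⊤` of `x ∨ ¬x ≈ ⊤` have no common upper bound: by admissibility
of the clause, such a bound would unify `x ≈ ⊤` or `¬x ≈ ⊤`, hence so would both of them. -/
theorem hasExactType_finitary (hn : 2 ≤ n)
    (hK : ∀ (A : Type u) [pLang.Structure A], K A → PDL A)
    (hB : ∀ φ ψ : pLang.Term ℕ, ClassValid K φ ψ → Valid (BPrime n) φ ψ) :
    HasExactType K .finitary := by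
  constructor
  · have h0 := zero_mem_vars_idLEM
    let σ₀ : Unifiers K {idLEM} :=
      ⟨fun _ => botT, (isUnifier_idLEM_iff _ h0).2 (classValid_lem_botT hK)⟩
    let σ₁ : Unifiers K {idLEM} :=
      ⟨fun _ => tTop, (isUnifier_idLEM_iff _ h0).2 (classValid_lem_tTop hK)⟩
    have : Nonempty (Unifiers K {idLEM}) := ⟨σ₀⟩
    refine ⟨{idLEM}, this,
      hasType_finitary (finite_range_kernel_unifiers hK _) (fun _ _ => Iff.rfl) ?_⟩
    rintro ⟨g, hg⟩
    have hsub : ∀ (φ : pLang.Term (vars {idLEM})) (σ : Unifiers K {idLEM}),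
        ClassValid K (φ.subst g.1) tTop → ClassValid K (φ.subst σ.1) tTop := by
      intro φ σ h
      have htop : ∀ ρ : Substitution pLang (vars {idLEM}), topT.subst ρ = tTop := fun ρ =>
        congrArg (Term.func _) (funext fun i => i.elim0)
      have : (φ, topT) ∈ kernel K σ.1 := hg σ (show (φ, topT) ∈ kernel K g.1 by
        simpa only [kernel, Set.mem_ofPred_eq, htop] using h)
      simpa only [kernel, Set.mem_ofPred_eq, htop] using this
    have hneg : ∀ ρ : Substitution pLang (vars {idLEM}),
        (negT (Term.var ⟨0, h0⟩)).subst ρ = tNeg (ρ ⟨0, h0⟩) := fun ρ =>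
      congrArg (Term.func _) (funext fun i => by fin_cases i; rfl)
    rcases classValid_or_of_complemented hn hK hB ((isUnifier_idLEM_iff _ h0).1 g.2) with h | h
    · exact not_classValid_of_realize_eq_bot hB (by simp [σ₀]) (hsub (Term.var ⟨0, h0⟩) σ₀ h)
    · have := hsub (negT (Term.var ⟨0, h0⟩)) σ₁ (by rwa [hneg])
      rw [hneg] at this
      exact not_classValid_of_realize_eq_bot hB (by simp [σ₁]) this
  · rintro s ⟨S, -, hs⟩
    exact hs.le_finitary_of_finite_range (finite_range_kernel_unifiers hK S) fun _ _ => Iff.rfl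

end ClauseAdmissible

/-! ### Nullary unification type -/

section Nullary

open PseudocomplLattice

/-- The identity `x₀ ∧ x₁ ≈ x₂ ∨ x₃`. -/
def idMeetJoin : pLang.Term ℕ × pLang.Term ℕ :=
  (infT (Term.var 0) (Term.var 1), supT (Term.var 2) (Term.var 3))

theorem mem_vars_idMeetJoin {i : ℕ} (hi : i < 4) : i ∈ vars {idMeetJoin} := by
  interval_cases i <;> simp [vars, idMeetJoin, infT, supT, Fin.exists_fin_two]

variable {K : AlgClass.{u} pLang} {n : ℕ}

theorem valid_app_idMeetJoin_iff {A : Type*} [PseudocomplLattice A] [pLang.Structure A]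
    [IsModel A] {σ : ℕ → pLang.Term ℕ} :
    Valid A (Substitution.app (X := vars {idMeetJoin}) (fun x => σ x) idMeetJoin.1)
      (Substitution.app (X := vars {idMeetJoin}) (fun x => σ x) idMeetJoin.2) ↔
    ∀ v : ℕ → A, (σ 0).realize v ⊓ (σ 1).realize v = (σ 2).realize v ⊔ (σ 3).realize v := by
  rw [valid_app_iff (Finset.mem_singleton_self _)]
  constructor
  · intro h v
    simpa [idMeetJoin] using h v (fun n => (σ n).realize v) fun _ => rfl
  · intro h v w hw
    have h0 := hw ⟨0, mem_vars_idMeetJoin (by simp)⟩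
    have h1 := hw ⟨1, mem_vars_idMeetJoin (by simp)⟩
    have h2 := hw ⟨2, mem_vars_idMeetJoin (by simp)⟩
    have h3 := hw ⟨3, mem_vars_idMeetJoin (by simp)⟩
    simp only [idMeetJoin, realize_infT, realize_supT, Term.realize_var]
    rw [h0, h1, h2, h3]
    exact h v

/-- Every substitution over the finite set `X` is the restriction of one over all variables. -/
theorem exists_extension {X : Finset ℕ} (σ : Substitution pLang X) :
    ∃ ρ : ℕ → pLang.Term ℕ, σ = fun x : X => ρ x :=
  ⟨fun n => if h : n ∈ X then σ ⟨n, h⟩ else Term.var n, funext fun x => by simp⟩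

theorem isUnifier_idMeetJoin_of_forall (hK : ∀ (A : Type u) [pLang.Structure A], K A → PDL A)
    {σ : ℕ → pLang.Term ℕ}
    (h : ∀ (A : Type u) [pLang.Structure A] [PseudocomplLattice A] [IsModel A], K A →
      ∀ v : ℕ → A, (σ 0).realize v ⊓ (σ 1).realize v = (σ 2).realize v ⊔ (σ 3).realize v) :
    IsUnifier K {idMeetJoin} (X := vars {idMeetJoin}) fun x => σ x := by
  intro e he A _ hA
  rw [Finset.mem_singleton] at he
  subst he
  obtain ⟨_, _⟩ := (hK A hA).exists_isModel
  exact valid_app_idMeetJoin_iff.2 (h A hA)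

theorem IsUnifier.idMeetJoin_realize {σ : ℕ → pLang.Term ℕ}
    (h : IsUnifier K {idMeetJoin} (X := vars {idMeetJoin}) fun x => σ x)
    {A : Type u} [pLang.Structure A] [PseudocomplLattice A] [IsModel A] (hA : K A) (v : ℕ → A) :
    (σ 0).realize v ⊓ (σ 1).realize v = (σ 2).realize v ⊔ (σ 3).realize v :=
  valid_app_idMeetJoin_iff.1 (h _ (Finset.mem_singleton_self _) A hA) v

/-- The solution set of `x₀ ∧ x₁ ≈ x₂ ∨ x₃` is closed under `(p ∧ a) ∨ (q ∧ b) ∨ (p ∧ q)`. -/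
theorem meet_eq_join_glue {A : Type*} [DistribLattice A] {p q : A} {a b : ℕ → A}
    (ha : a 0 ⊓ a 1 = a 2 ⊔ a 3) (hb : b 0 ⊓ b 1 = b 2 ⊔ b 3) :
    ((p ⊓ a 0) ⊔ (q ⊓ b 0) ⊔ (p ⊓ q)) ⊓ ((p ⊓ a 1) ⊔ (q ⊓ b 1) ⊔ (p ⊓ q)) =
      ((p ⊓ a 2) ⊔ (q ⊓ b 2) ⊔ (p ⊓ q)) ⊔ ((p ⊓ a 3) ⊔ (q ⊓ b 3) ⊔ (p ⊓ q)) := by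
  have hr : ((p ⊓ a 2) ⊔ (q ⊓ b 2) ⊔ (p ⊓ q)) ⊔ ((p ⊓ a 3) ⊔ (q ⊓ b 3) ⊔ (p ⊓ q)) =
      (p ⊓ (a 0 ⊓ a 1)) ⊔ (q ⊓ (b 0 ⊓ b 1)) ⊔ (p ⊓ q) := by
    rw [← sup_sup_distrib_right, sup_sup_sup_comm, ← inf_sup_left, ← inf_sup_left, ha, hb]
  rw [hr, ← sup_inf_right]
  refine le_antisymm (sup_le ?_ le_sup_right) (sup_le_sup_right ?_ _)
  · rw [inf_sup_left, inf_sup_right, inf_sup_right]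
    refine sup_le (sup_le ?_ ?_) (sup_le ?_ ?_)
    · exact le_sup_of_le_left (le_sup_of_le_left (inf_inf_distrib_left p _ _).ge)
    · exact le_sup_of_le_right (le_inf (inf_le_right.trans inf_le_left)
        (inf_le_left.trans inf_le_left))
    · exact le_sup_of_le_right (le_inf (inf_le_left.trans inf_le_left)
        (inf_le_right.trans inf_le_left))
    · exact le_sup_of_le_left (le_sup_of_le_right (inf_inf_distrib_left q _ _).ge)
  · rw [inf_inf_distrib_left p, inf_inf_distrib_left q]
    exact sup_le (inf_le_inf le_sup_left le_sup_left) (inf_le_inf le_sup_right le_sup_right)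

/-- The substitution `x ↦ (y ∧ σ₁(x)) ∨ (z ∧ σ₂(x)) ∨ (y ∧ z)`, where `y` and `z` are the variables
`0` and `1`, and the variables of `σ₁` and `σ₂` are shifted by two. -/
def glue (σ₁ σ₂ : ℕ → pLang.Term ℕ) (x : ℕ) : pLang.Term ℕ :=
  supT (supT (infT (Term.var 0) ((σ₁ x).relabel (· + 2)))
    (infT (Term.var 1) ((σ₂ x).relabel (· + 2)))) (infT (Term.var 0) (Term.var 1))

theorem lessGeneral_glue (hK : ∀ (A : Type u) [pLang.Structure A], K A → PDL A)
    (σ₁ σ₂ : ℕ → pLang.Term ℕ) (X : Finset ℕ) :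
    LessGeneral K (X := X) (fun x => σ₁ x) (fun x => glue σ₁ σ₂ x) ∧
      LessGeneral K (X := X) (fun x => σ₂ x) (fun x => glue σ₁ σ₂ x) := by
  refine ⟨⟨fun | 0 => topT | 1 => botT | n + 2 => Term.var n, fun x A _ hA v => ?_⟩,
    ⟨fun | 0 => botT | 1 => topT | n + 2 => Term.var n, fun x A _ hA v => ?_⟩⟩ <;>
  · obtain ⟨_, _⟩ := (hK A hA).exists_isModel
    simp [glue, Term.realize_subst, Function.comp_def]

theorem isUnifier_glue (hK : ∀ (A : Type u) [pLang.Structure A], K A → PDL A)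
    {σ₁ σ₂ : ℕ → pLang.Term ℕ}
    (h₁ : IsUnifier K {idMeetJoin} (X := vars {idMeetJoin}) fun x => σ₁ x)
    (h₂ : IsUnifier K {idMeetJoin} (X := vars {idMeetJoin}) fun x => σ₂ x) :
    IsUnifier K {idMeetJoin} (X := vars {idMeetJoin}) fun x => glue σ₁ σ₂ x := by
  refine isUnifier_idMeetJoin_of_forall hK fun A _ _ _ hA v => ?_
  simp only [glue, realize_supT, realize_infT, Term.realize_var, Term.realize_relabel]
  exact meet_eq_join_glue (a := fun i => (σ₁ i).realize (v ∘ (· + 2)))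
    (b := fun i => (σ₂ i).realize (v ∘ (· + 2))) (h₁.idMeetJoin_realize hA _)
    (h₂.idMeetJoin_realize hA _)

/-- The join of the terms `f i`, for `i ∈ F`. -/
noncomputable def bigSupT {ι : Type} (F : Finset ι) (f : ι → pLang.Term ℕ) : pLang.Term ℕ :=
  F.toList.foldr (fun i t => supT (f i) t) botT

theorem realize_bigSupT {A : Type*} [PseudocomplLattice A] [pLang.Structure A] [IsModel A]
    {ι : Type} (F : Finset ι) (f : ι → pLang.Term ℕ) (v : ℕ → A) :
    (bigSupT F f).realize v = F.sup fun i => (f i).realize v := by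
  classical
  have key : ∀ l : List ι, (l.foldr (fun i t => supT (f i) t) botT).realize v =
      l.toFinset.sup fun i => (f i).realize v := by
    intro l
    induction l with
    | nil => simp
    | cons i l ih => simp [ih]
  rw [bigSupT, key, Finset.toList_toFinset]

/-- The unifier of `x₀ ∧ x₁ ≈ x₂ ∨ x₃` in the variables `uᵢ` (with index `2i`) and `wᵢ` (with index
`2i + 1`), `i < N`, that sends `x₀` to the join of the `uᵢ`, `x₁` to the join of the `wᵢ`, `x₂` to
the join of the `uᵢ ∧ wⱼ` with `i ≠ j`, and `x₃` to the join of the `uᵢ ∧ wᵢ`. -/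
noncomputable def gridUnifier (N : ℕ) : ℕ → pLang.Term ℕ
  | 0 => bigSupT (Finset.univ : Finset (Fin N)) fun i => Term.var (2 * i)
  | 1 => bigSupT (Finset.univ : Finset (Fin N)) fun i => Term.var (2 * i + 1)
  | 2 => bigSupT (Finset.univ : Finset (Fin N)).offDiag fun p =>
      infT (Term.var (2 * p.1)) (Term.var (2 * p.2 + 1))
  | _ => bigSupT (Finset.univ : Finset (Fin N)) fun i =>
      infT (Term.var (2 * i)) (Term.var (2 * i + 1))

theorem isUnifier_gridUnifier (hK : ∀ (A : Type u) [pLang.Structure A], K A → PDL A) (N : ℕ) :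
    IsUnifier K {idMeetJoin} (X := vars {idMeetJoin}) fun x => gridUnifier N x := by
  refine isUnifier_idMeetJoin_of_forall hK fun A _ _ _ hA v => ?_
  simp only [gridUnifier, realize_bigSupT, realize_infT, Term.realize_var]
  rw [Finset.sup_inf_sup]
  refine le_antisymm (Finset.sup_le fun p _ => ?_)
    (sup_le (Finset.sup_le fun p _ => ?_) (Finset.sup_le fun i _ => ?_))
  · by_cases h : p.1 = p.2
    · refine le_sup_of_le_right ?_
      rw [← h]
      exact Finset.le_sup (f := fun i : Fin N => v (2 * i) ⊓ v (2 * i + 1)) (Finset.mem_univ p.1)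
    · refine le_sup_of_le_left ?_
      exact Finset.le_sup (f := fun p : Fin N × Fin N => v (2 * p.1) ⊓ v (2 * p.2 + 1))
        (by simpa using h)
  · exact Finset.le_sup (f := fun p : Fin N × Fin N => v (2 * p.1) ⊓ v (2 * p.2 + 1))
      (by simp)
  · exact Finset.le_sup (f := fun p : Fin N × Fin N => v (2 * p.1) ⊓ v (2 * p.2 + 1))
      (b := (i, i)) (by simp)

section Monotone

variable {A : Type*} [PseudocomplLattice A] [pLang.Structure A] [IsModel A]

theorem compl_realize_congr {v w : ℕ → A} (h : ∀ x, (v x)ᶜ = (w x)ᶜ) (φ : pLang.Term ℕ) :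
    (φ.realize v)ᶜ = (φ.realize w)ᶜ := by
  induction φ using pTerm_induction with
  | var x => exact h x
  | bot => simp
  | top => simp
  | neg φ ih => simp [ih]
  | inf φ ψ ih ih' => simp [compl_inf_eq, ih, ih']
  | sup φ ψ ih ih' => simp [compl_sup_eq, ih, ih']

/-- Among valuations with prescribed pseudocomplements all terms are monotone. -/
theorem realize_mono {v w : ℕ → A} (hle : ∀ x, v x ≤ w x) (h : ∀ x, (v x)ᶜ = (w x)ᶜ)
    (φ : pLang.Term ℕ) : φ.realize v ≤ φ.realize w := by
  induction φ using pTerm_induction with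
  | var x => exact hle x
  | bot => simp
  | top => simp
  | neg φ ih => simp [compl_realize_congr h φ]
  | inf φ ψ ih ih' => simpa using inf_le_inf ih ih'
  | sup φ ψ ih ih' => simpa using sup_le_sup ih ih'

end Monotone

/-- No unifier of `x₀ ∧ x₁ ≈ x₂ ∨ x₃` is more general than `gridUnifier N` for large `N`. If `σ`
were, with `σ` in finitely many variables, then by the pigeonhole principle two of the valuations
`uᵢ`, `uⱼ` would agree on the variables of `σ`. In their join with the valuation of `wⱼ` the terms
`σ(x₀)` and `σ(x₁)` are `⊤`, while `σ(x₂)` and `σ(x₃)` are bounded by their values under `uᵢ ∨ wⱼ`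
and `uⱼ ∨ wⱼ`, which are not `⊤`. -/
theorem exists_not_lessGeneral_gridUnifier [NeZero n]
    (hB : ∀ φ ψ : pLang.Term ℕ, ClassValid K φ ψ → Valid (BPrime n) φ ψ) {σ : ℕ → pLang.Term ℕ}
    (hσ : IsUnifier K {idMeetJoin} (X := vars {idMeetJoin}) fun x => σ x) :
    ∃ N, ¬ LessGeneral K (X := vars {idMeetJoin}) (fun x => gridUnifier N x) fun x => σ x := by
  classical
  let F : Finset ℕ := (Finset.range 4).biUnion fun x => (σ x).varFinset
  have : Finite (BPrime n) := inferInstanceAs (Finite (Option (Set (Fin n))))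
  obtain ⟨N, hN⟩ : ∃ N, N = Nat.card (F → BPrime n) + 1 := ⟨_, rfl⟩
  refine ⟨N, fun ⟨τ, hτ⟩ => ?_⟩
  -- The valuation whose values are `⊤` on `P` and the coatom elsewhere.
  let m : BPrime n := ((Set.univ : Set (Fin n)) : BPrime n)
  have hm : m ≠ ⊤ := WithTop.coe_ne_top
  let val : Set ℕ → ℕ → BPrime n := fun P k => if k ∈ P then ⊤ else m
  have hval : ∀ P k, (val P k)ᶜ = ⊥ := fun P k => by
    by_cases h : k ∈ P <;> simp [val, h, m, BPrime.compl_univ]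
  have hmono : ∀ {P Q : Set ℕ}, P ⊆ Q → ∀ k, val P k ≤ val Q k := fun {P Q} h k => by
    by_cases h' : k ∈ P
    · simp [val, h', h h']
    · by_cases h'' : k ∈ Q <;> simp [val, h', h'']
  let t : Set ℕ → ℕ → BPrime n := fun P k => (τ k).realize (val P)
  have htc : ∀ P Q k, (t P k)ᶜ = (t Q k)ᶜ := fun P Q k =>
    compl_realize_congr (fun x => (hval P x).trans (hval Q x).symm) _
  have htm : ∀ {P Q : Set ℕ}, P ⊆ Q → ∀ k, t P k ≤ t Q k := fun {P Q} h k =>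
    realize_mono (hmono h) (fun x => (hval P x).trans (hval Q x).symm) _
  have hgrid : ∀ x < 4, ∀ P, (σ x).realize (t P) = (gridUnifier N x).realize (val P) := by
    intro x hx P
    have := hB _ _ (hτ ⟨x, mem_vars_idMeetJoin hx⟩) (val P)
    rwa [Term.realize_subst] at this
  let u : Fin N → Set ℕ := fun i => {2 * (i : ℕ)}
  let w : Fin N → Set ℕ := fun i => {2 * (i : ℕ) + 1}
  obtain ⟨i, j, hij, heq⟩ : ∃ i j : Fin N, i ≠ j ∧
      (fun x : F => t (u i) x) = fun x : F => t (u j) x := by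
    have := Fintype.ofFinite (F → BPrime n)
    refine Fintype.exists_ne_map_eq_of_card_lt (fun (i : Fin N) (x : F) => t (u i) x) ?_
    rw [Fintype.card_fin, hN, Nat.card_eq_fintype_card]
    exact Nat.lt_succ_self _
  let J : ℕ → BPrime n := fun k => t (u i) k ⊔ t (w j) k
  let J' : ℕ → BPrime n := fun k => t (u j) k ⊔ t (w j) k
  have hJc : ∀ P k, (J k)ᶜ = (t P k)ᶜ := fun P k => by
    rw [compl_sup_eq, htc (u i) P, htc (w j) P, inf_idem]
  have hJc' : ∀ P k, (J' k)ᶜ = (t P k)ᶜ := fun P k => by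
    rw [compl_sup_eq, htc (u j) P, htc (w j) P, inf_idem]
  have h0 : (σ 0).realize J = ⊤ := by
    refine top_le_iff.1 (le_trans ?_
      (realize_mono (fun k => le_sup_left) (fun k => (hJc (u i) k).symm) (σ 0)))
    rw [hgrid 0 (by simp), gridUnifier, realize_bigSupT]
    exact le_trans (by simp [val, u]) (Finset.le_sup (Finset.mem_univ i))
  have h1 : (σ 1).realize J = ⊤ := by
    refine top_le_iff.1 (le_trans ?_
      (realize_mono (fun k => le_sup_right) (fun k => (hJc (w j) k).symm) (σ 1)))
    rw [hgrid 1 (by simp), gridUnifier, realize_bigSupT]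
    exact le_trans (by simp [val, w]) (Finset.le_sup (Finset.mem_univ j))
  have hinf : ∀ (P : Set ℕ) (k l : ℕ), k ∉ P ∨ l ∉ P → val P k ⊓ val P l ≤ m := by
    rintro P k l (h | h)
    · exact inf_le_left.trans (by simp [val, h])
    · exact inf_le_right.trans (by simp [val, h])
  have h2 : (σ 2).realize J ≤ m := by
    have hJJ : (σ 2).realize J = (σ 2).realize J' := realize_congr _ fun x hx => by
      have hxF : x ∈ F := Finset.mem_biUnion.2 ⟨2, by simp, hx⟩
      exact congrArg (· ⊔ t (w j) x) (congrFun heq ⟨x, hxF⟩)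
    rw [hJJ]
    refine (realize_mono (fun k => sup_le (htm Set.subset_union_left k)
      (htm Set.subset_union_right k)) (fun k => hJc' (u j ∪ w j) k) (σ 2)).trans ?_
    rw [hgrid 2 (by simp), gridUnifier, realize_bigSupT]
    refine Finset.sup_le fun p hp => ?_
    simp only [realize_infT, Term.realize_var]
    refine hinf _ _ _ ?_
    have hp : (p.1 : ℕ) ≠ p.2 := by simpa [Fin.ext_iff] using hp
    simp only [u, w, Set.mem_union, Set.mem_singleton_iff]
    lia
  have h3 : (σ 3).realize J ≤ m := by
    refine (realize_mono (fun k => sup_le (htm Set.subset_union_left k)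
      (htm Set.subset_union_right k)) (fun k => hJc (u i ∪ w j) k) (σ 3)).trans ?_
    rw [hgrid 3 (by simp), gridUnifier, realize_bigSupT]
    · refine Finset.sup_le fun k _ => ?_
      simp only [realize_infT, Term.realize_var]
      refine hinf _ _ _ ?_
      have hij : (i : ℕ) ≠ j := by simpa [Fin.ext_iff] using hij
      simp only [u, w, Set.mem_union, Set.mem_singleton_iff]
      lia
    all_goals simp
  have hv := valid_app_idMeetJoin_iff.1 (hB _ _ (hσ _ (Finset.mem_singleton_self _))) J
  rw [h0, h1, inf_top_eq] at hv
  exact hm (top_le_iff.1 (hv.le.trans (sup_le h2 h3)))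

/-- The unifiers of `x₀ ∧ x₁ ≈ x₂ ∨ x₃` are directed and have no greatest element. -/
theorem hasUnificationType_nullary [NeZero n]
    (hK : ∀ (A : Type u) [pLang.Structure A], K A → PDL A)
    (hB : ∀ φ ψ : pLang.Term ℕ, ClassValid K φ ψ → Valid (BPrime n) φ ψ) :
    HasUnificationType K .nullary := by
  refine ⟨⟨{idMeetJoin}, ⟨⟨_, isUnifier_gridUnifier hK 0⟩⟩, ?_⟩, fun s _ => s.le_nullary⟩
  have : Nonempty (Unifiers K {idMeetJoin}) := ⟨⟨_, isUnifier_gridUnifier hK 0⟩⟩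
  refine hasType_nullary_of_directed (fun x y z h h' => LessGeneral.trans h h') ?_ ?_
  · rintro ⟨σ₁, h₁⟩ ⟨σ₂, h₂⟩
    obtain ⟨ρ₁, rfl⟩ := exists_extension σ₁
    obtain ⟨ρ₂, rfl⟩ := exists_extension σ₂
    exact ⟨⟨_, isUnifier_glue hK h₁ h₂⟩, lessGeneral_glue hK ρ₁ ρ₂ _⟩
  · rintro ⟨⟨σ, hσ⟩, hg⟩
    obtain ⟨ρ, rfl⟩ := exists_extension σ
    obtain ⟨N, hN⟩ := exists_not_lessGeneral_gridUnifier hB hσ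
    exact hN (hg ⟨_, isUnifier_gridUnifier hK N⟩)

end Nullary

/-! ### The varieties -/

/-- The arguments about `𝔅_ω` and `𝔅_n` use only that the members of the class are pseudocomplemented
distributive lattices and that some `B_n'` with `n ≥ 2` satisfies its identities. -/
theorem pdl_or_bVar {K : AlgClass.{u} pLang}
    (hK : K = PDL.{u} ∨ ∃ n : ℕ, 2 ≤ n ∧ K = BVar.{u} n) :
    (∀ (A : Type u) [pLang.Structure A], K A → PDL A) ∧
      ∃ n : ℕ, 2 ≤ n ∧ ∀ φ ψ : pLang.Term ℕ,
        ClassValid K φ ψ → Valid (BPrime n) φ ψ := by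
  rcases hK with rfl | ⟨n, hn, rfl⟩
  · exact ⟨fun _ _ h => h, 2, le_rfl, fun φ ψ h =>
      (valid_ulift_iff φ ψ).1 (h _ (BPrime.pdl 2).ulift)⟩
  · exact ⟨fun _ _ h => h.1, n, hn, fun φ ψ => classValid_bVar_iff.1⟩

end ExactUnif

theorem mainTheorem12 :
    -- Stone algebras
    ((∀ (A : Type u) [ExactUnif.pLang.Structure A],
        ExactUnif.StoneAlg A ↔ ExactUnif.BVar 1 A) ∧
      ExactUnif.HasUnificationType ExactUnif.StoneAlg.{u} .nullary ∧
      ExactUnif.HasExactType ExactUnif.StoneAlg.{u} .unitary) ∧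
    -- pseudocomplemented distributive lattices and the subvarieties `𝔅_n`, `n ≥ 2`
    ∀ K : ExactUnif.AlgClass.{u} ExactUnif.pLang,
      (K = ExactUnif.PDL.{u} ∨ ∃ n : ℕ, 2 ≤ n ∧ K = ExactUnif.BVar.{u} n) →
      ExactUnif.HasUnificationType K .nullary ∧
      ExactUnif.HasExactType K .finitary ∧
      ExactUnif.LocallyFiniteClass K ∧
      ExactUnif.Admissible K {ExactUnif.idLEM} ExactUnif.idXOrNegX ∧
      ¬ ExactUnif.Admissible K {ExactUnif.idLEM} {ExactUnif.idX} ∧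
      ¬ ExactUnif.Admissible K {ExactUnif.idLEM} {ExactUnif.idNegX} := by
  refine ⟨⟨fun A _ => ExactUnif.stoneAlg_iff_bVar_one A, ?_, ?_⟩, fun K hKn => ?_⟩
  · rw [ExactUnif.stoneAlg_eq_bVar_one]
    exact ExactUnif.hasUnificationType_nullary (n := 1) (fun _ _ h => h.1)
      fun φ ψ => ExactUnif.classValid_bVar_iff.1
  · rw [ExactUnif.stoneAlg_eq_bVar_one]
    exact ExactUnif.hasExactType_bVar_one
  · obtain ⟨hK, n, hn, hB⟩ := ExactUnif.pdl_or_bVar hKn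
    have : NeZero n := ⟨by lia⟩
    exact ⟨ExactUnif.hasUnificationType_nullary hK hB, ExactUnif.hasExactType_finitary hn hK hB,
      ExactUnif.locallyFiniteClass_PDL.mono hK, ExactUnif.admissible_idLEM hn hK hB,
      ExactUnif.not_admissible_idX hK hB, ExactUnif.not_admissible_idNegX hK hB⟩
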